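/- **Definitions.** A pointed monoid is a commutative monoid $B$ with an absorbing element $0$. Its ambient semiring $B^+$ is the semiring $\mathbb N[B]$ of formal sums of elements of $B$, in which $0\in B$ is identified with the empty sum. A *band* is a pointed monoid $B$ together with an ideal $N_B\subset B^+$ (the null set) such that for every $a\in B$ there is a unique $b\in B$ with $a+b\in N_B$. A *band morphism* $f:B\to C$ is a multiplicative map with $f(0)=0$, $f(1)=1$ such that $\sum a_i\in N_B$ implies $\sum f(a_i)\in N_C$. This defines the category $\mathrm{Bands}$. For a multiplicative subset $S\subset B$, the localization $S^{-1}B$ is the usual monoid of fractions with null set generated by the sums $\sum \frac{a_i}{1}$ for $\sum a_i\in N_B$; we write $B[h^{-1}]$ for $S=\{h^i\}_{i\ge 0}$. A *prime $m$-ideal* of $B$ is a subset $\mathfrak p\subset B$ with $0\in\mathfrak p$ and $B\cdot\mathfrak p=\mathfrak p$ whose complement contains $1$ and is closed under multiplication. The spectrum $\operatorname{Spec}B$ is the set of prime $m$-ideals of $B$ with the topology generated by the sets $U_h=\{\mathfrak p\mid h\notin\mathfrak p\}$, $h\in B$, and with the structure sheaf of bands characterized by $\mathcal O(U_h)=B[h^{-1}]$.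 A *band space* is a topological space $X$ with a sheaf $\mathcal O_X$ in $\mathrm{Bands}$; a morphism of band spaces is a continuous map $\varphi:X\to Y$ together with a morphism of sheaves $\varphi^\#:\mathcal O_Y\to\varphi_*\mathcal O_X$ whose induced maps on stalks $\mathcal O_{Y,\varphi(x)}\to\mathcal O_{X,x}$ send non-units to non-units. An *affine band scheme* is a band space isomorphic to $\operatorname{Spec}B$ for some band $B$; a *band scheme* is a band space in which every point has an open neighbourhood that is an affine band scheme. Morphisms of (affine) band schemes are morphisms of band spaces; this defines the categories $\mathrm{BAff}\subset\mathrm{BSch}$. A band morphism $f:B\to C$ induces a morphism $\operatorname{Spec}C\to\operatorname{Spec}B$, $\mathfrak q\mapsto f^{-1}(\mathfrak q)$, so that $\operatorname{Spec}$ is a contravariant functor from $\mathrm{Bands}$ to $\mathrm{BSch}$ with values in $\mathrm{BAff}$. Let $\Gamma X=\mathcal O_X(X)$, a contravariant functor from $\mathrm{BSch}$ to $\mathrm{Bands}$. **Theorem.** 1. The functor $\operatorname{Spec}:\mathrm{Bands}^{\mathrm{op}}\to\mathrm{BSch}$ is fully faithful. 2. For every band scheme $X$ and every band $B$, pulling back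 global sections (i.e. sending $\varphi$ to the composition of the canonical map $B\to\Gamma\operatorname{Spec}B$ with $\Gamma\varphi$) is a bijection $$\Phi:\ \operatorname{Hom}(X,\operatorname{Spec}B)\longrightarrow\operatorname{Hom}(B,\Gamma X),$$ which is functorial in $X$ and $B$. In other words, $\Phi$ is the bijection of an adjunction between $\Gamma:\mathrm{BSch}\to\mathrm{Bands}^{\mathrm{op}}$ (left adjoint) and $\operatorname{Spec}:\mathrm{Bands}^{\mathrm{op}}\to\mathrm{BSch}$ (right adjoint). 3. $\operatorname{Spec}:\mathrm{Bands}^{\mathrm{op}}\to\mathrm{BAff}$ is an equivalence of categories with inverse $\Gamma$. 4. $\mathrm{BAff}$ is a reflective subcategory of $\mathrm{BSch}$ with reflection $\operatorname{Spec}\circ\Gamma:\mathrm{BSch}\to\mathrm{BAff}$. -/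

import Mathlib

open CategoryTheory CategoryTheory.Limits TopologicalSpace Opposite

universe u v

noncomputable section

namespace Bands

/-! ### Ambient semirings and bands -/

/-- The relation on the semiring `ℕ[B]` of formal sums of elements of `B` that identifies the
element `0` of `B` with the empty sum. -/
def ZeroRel (B : Type u) [CommMonoidWithZero B] (x y : MonoidAlgebra ℕ B) : Prop :=
  x = MonoidAlgebra.single (0 : B) 1 ∧ y = 0

/-- The ambient semiring `B⁺` of a pointed monoid `B`: formal sums of elements of `B`, where `0 : B`
is identified with the empty sum. -/
def Ambient (B : Type u) [CommMonoidWithZero B] : Type u :=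
  (ringConGen (ZeroRel B)).Quotient

namespace Ambient

variable {B : Type u} [CommMonoidWithZero B] {C : Type v} [CommMonoidWithZero C]

instance : CommSemiring (Ambient B) :=
  inferInstanceAs (CommSemiring (ringConGen (ZeroRel B)).Quotient)

/-- The quotient map `ℕ[B] → B⁺`. -/
def mk : MonoidAlgebra ℕ B →+* Ambient B := (ringConGen (ZeroRel B)).mk'

/-- The inclusion of `B` into `B⁺`. -/
def of : B →*₀ Ambient B where
  toFun b := mk (MonoidAlgebra.of ℕ B b)
  map_zero' := by
    have h : (ringConGen (ZeroRel B)) (MonoidAlgebra.single (0 : B) 1) 0 :=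
      RingConGen.Rel.of _ _ ⟨rfl, rfl⟩
    exact ((ringConGen (ZeroRel B)).eq).2 h
  map_one' := by rw [map_one, map_one]
  map_mul' a b := by rw [map_mul, map_mul]

/-- The universal property of `B⁺`. -/
def lift {R : Type v} [CommSemiring R] (f : B →*₀ R) : Ambient B →+* R :=
  (ringConGen (ZeroRel B)).lift
    ((MonoidAlgebra.lift ℕ R B (f : B →* R) : MonoidAlgebra ℕ B →ₐ[ℕ] R) :
      MonoidAlgebra ℕ B →+* R) (by
    rw [RingCon.ringConGen_le]
    rintro x y ⟨rfl, rfl⟩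
    rw [RingCon.ker_apply]
    simp)

@[simp] lemma lift_of {R : Type v} [CommSemiring R] (f : B →*₀ R) (b : B) :
    lift f (of b) = f b := by
  change (MonoidAlgebra.lift ℕ R B (f : B →* R)) (MonoidAlgebra.of ℕ B b) = f b
  simp

lemma induction {P : Ambient B → Prop} (zero : P 0) (of_ : ∀ b, P (of b))
    (add : ∀ x y, P x → P y → P (x + y)) (x : Ambient B) : P x := by
  obtain ⟨x, rfl⟩ := Quotient.exists_rep x
  change P (mk x)
  induction x using MonoidAlgebra.induction_on with
  | of b => exact of_ b
  | add x y hx hy => rw [map_add]; exact add _ _ hx hy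
  | smul n x hx =>
    rw [map_nsmul]
    induction n with
    | zero => rw [zero_nsmul]; exact zero
    | succ n ih => rw [succ_nsmul]; exact add _ _ ih hx

lemma hom_ext {R : Type v} [CommSemiring R] {f g : Ambient B →+* R}
    (h : ∀ b, f (of b) = g (of b)) : f = g := by
  ext x
  induction x using induction with
  | zero => simp
  | of_ b => exact h b
  | add x y hx hy => rw [map_add, map_add, hx, hy]

/-- The semiring homomorphism `f⁺ : B⁺ → C⁺`, `∑ aᵢ ↦ ∑ f aᵢ`. -/
def map (f : B →*₀ C) : Ambient B →+* Ambient C := lift (of.comp f)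

@[simp] lemma map_of (f : B →*₀ C) (b : B) : map f (of b) = of (f b) := by
  simp [map]

lemma map_id : map (MonoidWithZeroHom.id B) = RingHom.id _ := hom_ext fun b => by simp

lemma map_map {D : Type*} [CommMonoidWithZero D] (g : C →*₀ D) (f : B →*₀ C) (x : Ambient B) :
    map g (map f x) = map (g.comp f) x := by
  have : (map g).comp (map f) = map (g.comp f) := hom_ext fun b => by simp
  exact RingHom.congr_fun this x

end Ambient

/-- A band: a pointed commutative monoid together with an ideal of its ambient semiring, the null
set, such that each element has a unique additive inverse. -/
class Band (B : Type u) extends CommMonoidWithZero B where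
  /-- The null set. -/
  nullSet : Ideal (Ambient B)
  existsUnique_neg : ∀ a : B, ∃! b : B, Ambient.of a + Ambient.of b ∈ nullSet

/-- The null set of a band. -/
abbrev nullSet (B : Type u) [Band B] : Ideal (Ambient B) := Band.nullSet

/-- A band morphism: a morphism of pointed monoids mapping the null set into the null set. -/
structure BandHom (B : Type u) (C : Type v) [Band B] [Band C] extends B →*₀ C where
  map_null' : ∀ x ∈ nullSet B, Ambient.map toMonoidWithZeroHom x ∈ nullSet C

namespace BandHom

variable {B : Type u} {C : Type v} [Band B] [Band C]

instance : FunLike (BandHom B C) B C where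
  coe f := f.toFun
  coe_injective f g h := by
    cases f; cases g; congr; exact DFunLike.coe_injective h

instance : MonoidWithZeroHomClass (BandHom B C) B C where
  map_mul f := f.map_mul'
  map_one f := f.map_one'
  map_zero f := f.map_zero'

@[ext] lemma ext' {f g : BandHom B C} (h : ∀ b, f b = g b) : f = g := DFunLike.ext _ _ h

@[simp] lemma toMonoidWithZeroHom_apply (f : BandHom B C) (b : B) :
    f.toMonoidWithZeroHom b = f b := rfl

@[simp] lemma mk_apply (f : B →*₀ C) (h) (b : B) : (⟨f, h⟩ : BandHom B C) b = f b := rfl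

/-- The identity morphism. -/
def id (B : Type u) [Band B] : BandHom B B where
  toMonoidWithZeroHom := MonoidWithZeroHom.id B
  map_null' x hx := by rwa [Ambient.map_id]

/-- The composition of band morphisms. -/
def comp {D : Type*} [Band D] (g : BandHom C D) (f : BandHom B C) : BandHom B D where
  toMonoidWithZeroHom := g.toMonoidWithZeroHom.comp f.toMonoidWithZeroHom
  map_null' x hx := by
    rw [← Ambient.map_map]; exact g.map_null' _ (f.map_null' _ hx)

@[simp] lemma id_apply (b : B) : id B b = b := rfl
@[simp] lemma comp_apply {D : Type*} [Band D] (g : BandHom C D) (f : BandHom B C) (b : B) :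
    g.comp f b = g (f b) := rfl

end BandHom

section neg

variable {B : Type u} [Band B]

/-- The additive inverse. -/
def neg (a : B) : B := (Band.existsUnique_neg a).choose

lemma add_neg_mem (a : B) : Ambient.of a + Ambient.of (neg a) ∈ nullSet B :=
  (Band.existsUnique_neg a).choose_spec.1

lemma eq_neg_of_mem {a b : B} (h : Ambient.of a + Ambient.of b ∈ nullSet B) : b = neg a :=
  (Band.existsUnique_neg a).choose_spec.2 b h

lemma neg_mul' (a b : B) : neg a * b = neg (a * b) := by
  apply eq_neg_of_mem
  rw [map_mul, map_mul, ← add_mul]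
  exact Ideal.mul_mem_right _ _ (add_neg_mem a)

lemma map_neg {C : Type v} [Band C] (f : BandHom B C) (a : B) : f (neg a) = neg (f a) := by
  apply eq_neg_of_mem
  have := f.map_null' _ (add_neg_mem a)
  rw [map_add] at this
  simpa using this

end neg

/-! ### The category of bands -/

/-- The category of bands. -/
structure BandCat : Type (u + 1) where
  /-- The underlying type. -/
  carrier : Type u
  [str : Band carrier]

namespace BandCat

instance : CoeSort BandCat.{u} (Type u) := ⟨carrier⟩

attribute [instance] str

/-- Morphisms in the category of bands. -/
@[ext]
structure Hom (B C : BandCat.{u}) where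
  /-- The underlying band morphism. -/
  hom' : BandHom B C

instance : Category BandCat.{u} where
  Hom := Hom
  id B := ⟨BandHom.id B⟩
  comp f g := ⟨g.hom'.comp f.hom'⟩

instance : ConcreteCategory BandCat.{u} (fun B C => BandHom B C) where
  hom f := f.hom'
  ofHom f := ⟨f⟩

/-- The object of the category of bands associated with a band. -/
abbrev of (B : Type u) [Band B] : BandCat.{u} := ⟨B⟩

/-- The morphism in the category of bands associated with a band morphism. -/
abbrev ofHom {B C : Type u} [Band B] [Band C] (f : BandHom B C) : of B ⟶ of C :=
  ConcreteCategory.ofHom f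

/-- The band morphism underlying a morphism in the category of bands. -/
abbrev hom {B C : BandCat.{u}} (f : B ⟶ C) : BandHom B C := ConcreteCategory.hom f

end BandCat

/-! ### Colimits of bands -/

namespace Colim

variable {J : Type u} [Category.{u} J] (F : J ⥤ BandCat.{u})

/-- Formal expressions in the elements of the bands of a diagram. -/
inductive Pre : Type u
  | of (j : J) (x : F.obj j) : Pre
  | zero : Pre
  | one : Pre
  | neg (x : Pre) : Pre
  | mul (x y : Pre) : Pre

variable {F}

/-- The value of a formal expression in a cocone. -/
def Pre.eval (s : Cocone F) : Pre F → s.pt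
  | .of j x => s.ι.app j x
  | .zero => 0
  | .one => 1
  | .neg x => Bands.neg (x.eval s)
  | .mul x y => x.eval s * y.eval s

variable (F)

/-- Two formal expressions are identified if they agree in all cocones. -/
def setoid : Setoid (Pre F) where
  r x y := ∀ s : Cocone F, x.eval s = y.eval s
  iseqv := ⟨fun _ _ => rfl, fun h s => (h s).symm, fun h h' s => (h s).trans (h' s)⟩

/-- The underlying type of the colimit. -/
def Pt : Type u := _root_.Quotient (setoid F)

variable {F} in
/-- The class of a formal expression. -/
def Pt.mk (x : Pre F) : Pt F := Quotient.mk (setoid F) x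

variable {F} in
lemma Pt.exists_mk (x : Pt F) : ∃ y : Pre F, Pt.mk y = x := Quotient.exists_rep x

instance : CommMonoidWithZero (Pt F) where
  zero := Quotient.mk (setoid F) .zero
  one := Quotient.mk (setoid F) .one
  mul := Quotient.map₂ .mul (fun _ _ h _ _ h' s => congrArg₂ (· * ·) (h s) (h' s))
  mul_assoc := by
    rintro ⟨x⟩ ⟨y⟩ ⟨z⟩; exact Quotient.sound fun s => mul_assoc (x.eval s) (y.eval s) (z.eval s)
  mul_comm := by
    rintro ⟨x⟩ ⟨y⟩; exact Quotient.sound fun s => mul_comm (x.eval s) (y.eval s)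
  one_mul := by
    rintro ⟨x⟩; exact Quotient.sound fun s => one_mul (x.eval s)
  mul_one := by
    rintro ⟨x⟩; exact Quotient.sound fun s => mul_one (x.eval s)
  zero_mul := by
    rintro ⟨x⟩; exact Quotient.sound fun s => zero_mul (x.eval s)
  mul_zero := by
    rintro ⟨x⟩; exact Quotient.sound fun s => mul_zero (x.eval s)

variable {F}

/-- The map from the colimit to the point of a cocone. -/
def evalHom (s : Cocone F) : Pt F →*₀ s.pt where
  toFun := Quotient.lift (Pre.eval s) fun _ _ h => h s
  map_zero' := rfl
  map_one' := rfl
  map_mul' := by rintro ⟨x⟩ ⟨y⟩; rfl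

@[simp] lemma evalHom_mk (s : Cocone F) (x : Pre F) : evalHom s (Pt.mk x) = x.eval s := rfl

lemma pt_ext {x y : Pt F} (h : ∀ s : Cocone F, evalHom s x = evalHom s y) : x = y := by
  obtain ⟨x⟩ := x
  obtain ⟨y⟩ := y
  exact Quotient.sound h

instance : Band (Pt F) where
  nullSet := ⨅ s : Cocone F, (nullSet s.pt).comap (Ambient.map (evalHom s))
  existsUnique_neg := by
    intro x
    obtain ⟨x, rfl⟩ := Pt.exists_mk x
    refine ⟨Pt.mk (.neg x), ?_, ?_⟩
    · simp only [Ideal.mem_iInf, Ideal.mem_comap, map_add, Ambient.map_of, evalHom_mk]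
      exact fun s => add_neg_mem (x.eval s)
    · intro b hb
      simp only [Ideal.mem_iInf, Ideal.mem_comap, map_add, Ambient.map_of, evalHom_mk] at hb
      exact pt_ext fun s => eq_neg_of_mem (hb s)

/-- The descent morphism. -/
def desc (s : Cocone F) : BandHom (Pt F) s.pt where
  toMonoidWithZeroHom := evalHom s
  map_null' _ hx := Ideal.mem_comap.1 ((Ideal.mem_iInf.1 hx) s)

/-- The coprojections. -/
def incl (j : J) : BandHom (F.obj j) (Pt F) where
  toFun x := Quotient.mk _ (.of j x)
  map_zero' := Quotient.sound fun s => map_zero (s.ι.app j).hom'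
  map_one' := Quotient.sound fun s => map_one (s.ι.app j).hom'
  map_mul' x y := Quotient.sound fun s => map_mul (s.ι.app j).hom' x y
  map_null' x hx := by
    refine Ideal.mem_iInf.2 fun s => Ideal.mem_comap.2 ?_
    rw [Ambient.map_map]
    exact (s.ι.app j).hom'.map_null' x hx

lemma desc_incl (s : Cocone F) (j : J) (x : F.obj j) : desc s (incl j x) = s.ι.app j x := rfl

variable (F)

/-- The colimit cocone. -/
def cocone : Cocone F where
  pt := BandCat.of (Pt F)
  ι :=
    { app := fun j => BandCat.ofHom (incl j)
      naturality := fun i j f => by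
        apply ConcreteCategory.hom_ext
        intro x
        refine pt_ext fun s => ?_
        exact ConcreteCategory.congr_hom (s.w f) x }

variable {F} in
lemma mk_neg (x : Pre F) : Pt.mk (.neg x) = neg (Pt.mk x) :=
  pt_ext fun s => (map_neg (desc s) (Pt.mk x)).symm

variable {F} in
lemma mk_mul (x y : Pre F) : Pt.mk (.mul x y) = Pt.mk x * Pt.mk y := rfl

/-- The colimit cocone is a colimit. -/
def isColimit : IsColimit (cocone F) where
  desc s := BandCat.ofHom (desc s)
  fac s j := rfl
  uniq s m hm := by
    apply ConcreteCategory.hom_ext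
    intro x
    obtain ⟨x, rfl⟩ := Pt.exists_mk x
    let m' : BandHom (Pt F) s.pt := BandCat.hom m
    change m' (Pt.mk x) = x.eval s
    induction x with
    | of j x => exact ConcreteCategory.congr_hom (hm j) x
    | zero => exact map_zero m'
    | one => exact map_one m'
    | neg x ih => rw [mk_neg, map_neg, ih]; rfl
    | mul x y ihx ihy => rw [mk_mul, map_mul, ihx, ihy]; rfl

lemma exists_incl [IsFiltered J] (x : Pt F) : ∃ (j : J) (y : F.obj j), incl j y = x := by
  have hw {i j : J} (f : i ⟶ j) (y : F.obj i) : incl j (F.map f y) = incl i y :=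
    ConcreteCategory.congr_hom ((cocone F).w f) y
  obtain ⟨x, rfl⟩ := Pt.exists_mk x
  induction x with
  | of j x => exact ⟨j, x, rfl⟩
  | zero => exact ⟨IsFiltered.nonempty.some, 0, map_zero (incl _)⟩
  | one => exact ⟨IsFiltered.nonempty.some, 1, map_one (incl _)⟩
  | neg x ih =>
    obtain ⟨j, y, hy⟩ := ih
    refine ⟨j, neg y, ?_⟩
    rw [map_neg, hy, mk_neg]
  | mul x y ihx ihy =>
    obtain ⟨i, a, ha⟩ := ihx
    obtain ⟨j, b, hb⟩ := ihy
    refine ⟨IsFiltered.max i j, F.map (IsFiltered.leftToMax i j) a *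
      F.map (IsFiltered.rightToMax i j) b, ?_⟩
    refine (map_mul (incl _) _ _).trans ?_
    rw [hw, hw, ha, hb]
    rfl

end Colim

instance : HasColimits BandCat.{u} where
  has_colimits_of_shape _ _ :=
    { has_colimit := fun F => ⟨⟨⟨Colim.cocone F, Colim.isColimit F⟩⟩⟩ }

lemma exists_germ_eq {X : TopCat.{u}} (P : X.Presheaf BandCat.{u}) (x : X) (a : P.stalk x) :
    ∃ (U : Opens X) (hx : x ∈ U) (s : P.obj (op U)), P.germ U x hx s = a := by
  let D := (OpenNhds.inclusion x).op ⋙ P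
  let e := (colimit.isColimit D).coconePointUniqueUpToIso (Colim.isColimit D)
  obtain ⟨U, s, hs⟩ := Colim.exists_incl D (e.hom a)
  refine ⟨U.unop.1, U.unop.2, s, ?_⟩
  have h1 : P.germ U.unop.1 x U.unop.2 = (Colim.cocone D).ι.app U ≫ e.inv :=
    ((colimit.isColimit D).comp_coconePointUniqueUpToIso_inv (Colim.isColimit D) U).symm
  rw [h1]
  change e.inv (Colim.incl U s) = a
  rw [hs]
  exact ConcreteCategory.congr_hom e.hom_inv_id a

/-! ### Localizations -/

namespace Loc

section

variable {B : Type u} [CommMonoidWithZero B] (S : Submonoid B)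

/-- The localization map `a ↦ a / 1` as a morphism of pointed monoids. -/
def ι : B →*₀ Localization S where
  toFun a := Localization.mk a 1
  map_zero' := Localization.mk_zero 1
  map_one' := Localization.mk_one
  map_mul' a b := by rw [Localization.mk_mul, one_mul]

lemma isUnit_ι (s : S) : IsUnit (ι S s) := (Localization.monoidOf S).map_units s

lemma exists_ι_mul (x : Localization S) : ∃ (s : S) (a : B), ι S s * x = ι S a := by
  obtain ⟨⟨a, s⟩, h⟩ := (Localization.monoidOf S).surj x
  exact ⟨s, a, by rw [mul_comm]; exact h⟩

lemma exists_map_mul (x : Ambient (Localization S)) :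
    ∃ (s : S) (y : Ambient B), Ambient.of (ι S s) * x = Ambient.map (ι S) y := by
  induction x using Ambient.induction with
  | zero => exact ⟨1, 0, by simp⟩
  | of_ b =>
    obtain ⟨s, a, h⟩ := exists_ι_mul S b
    exact ⟨s, Ambient.of a, by rw [← map_mul, h, Ambient.map_of]⟩
  | add x y hx hy =>
    obtain ⟨s, x', hx⟩ := hx
    obtain ⟨t, y', hy⟩ := hy
    refine ⟨s * t, Ambient.of (t : B) * x' + Ambient.of (s : B) * y', ?_⟩
    rw [map_add, map_mul, map_mul, ← hx, ← hy, Ambient.map_of, Ambient.map_of,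
      Submonoid.coe_mul, map_mul, map_mul]
    ring

lemma exists_of_map_eq {x y : Ambient B} (h : Ambient.map (ι S) x = Ambient.map (ι S) y) :
    ∃ s : S, Ambient.of (s : B) * x = Ambient.of (s : B) * y := by
  let T : Submonoid (Ambient B) := S.map (Ambient.of : B →*₀ Ambient B)
  let j : Ambient B →+* Localization T := algebraMap _ _
  have hj (s : S) : IsUnit (j.toMonoidWithZeroHom.comp Ambient.of (s : B)) :=
    IsLocalization.map_units (Localization T) (⟨_, ⟨s, s.2, rfl⟩⟩ : T)
  let k : Ambient (Localization S) →+* Localization T :=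
    Ambient.lift ((Localization.monoidOf S).lift₀
      (j.toMonoidWithZeroHom.comp Ambient.of) hj)
  have hk : k.comp (Ambient.map (ι S)) = j := by
    refine Ambient.hom_ext fun b => ?_
    rw [RingHom.comp_apply, Ambient.map_of, Ambient.lift_of]
    exact (Localization.monoidOf S).lift_eq hj b
  have h' : j x = j y := by
    rw [← hk, RingHom.comp_apply, RingHom.comp_apply, h]
  obtain ⟨⟨_, ⟨s, hs, rfl⟩⟩, hc⟩ := IsLocalization.exists_of_eq (M := T) h'
  exact ⟨⟨s, hs⟩, hc⟩

end

variable {B : Type u} [Band B] (S : Submonoid B)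

lemma exists_of_mem {x : Ambient (Localization S)}
    (hx : x ∈ Ideal.map (Ambient.map (ι S)) (nullSet B)) :
    ∃ (s : S), ∃ y ∈ nullSet B, Ambient.of (ι S s) * x = Ambient.map (ι S) y := by
  refine Submodule.span_induction ?_ ?_ ?_ ?_ hx
  · rintro _ ⟨y, hy, rfl⟩
    exact ⟨1, y, hy, by simp⟩
  · exact ⟨1, 0, zero_mem _, by simp⟩
  · rintro x y - - ⟨s, x', hx', hx⟩ ⟨t, y', hy', hy⟩
    refine ⟨s * t, Ambient.of (t : B) * x' + Ambient.of (s : B) * y',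
      add_mem (Ideal.mul_mem_left _ _ hx') (Ideal.mul_mem_left _ _ hy'), ?_⟩
    rw [map_add, map_mul, map_mul, ← hx, ← hy, Ambient.map_of, Ambient.map_of,
      Submonoid.coe_mul, map_mul, map_mul]
    ring
  · rintro c x - ⟨s, x', hx', hx⟩
    obtain ⟨t, c', hc⟩ := exists_map_mul S c
    refine ⟨t * s, c' * x', Ideal.mul_mem_left _ _ hx', ?_⟩
    rw [map_mul, ← hx, ← hc, Submonoid.coe_mul, map_mul, map_mul, smul_eq_mul]
    ring

lemma eq_of_mem {a b : Localization S}
    (h : Ambient.of a + Ambient.of b ∈ Ideal.map (Ambient.map (ι S)) (nullSet B)) :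
    b = ι S (neg 1) * a := by
  obtain ⟨s, y, hy, hs⟩ := exists_of_mem S h
  obtain ⟨t, a', ha⟩ := exists_ι_mul S a
  obtain ⟨r, b', hb⟩ := exists_ι_mul S b
  have h1 : Ambient.map (ι S) (Ambient.of (t * r : B) * y) =
      Ambient.map (ι S) (Ambient.of (s * r * a' : B) + Ambient.of (s * t * b' : B)) := by
    simp only [map_mul, map_add, Ambient.map_of, ← hs, ← ha, ← hb]
    ring
  obtain ⟨v, hv⟩ := exists_of_map_eq S h1
  have h2 : Ambient.of (v * (s * r * a') : B) + Ambient.of (v * (s * t * b') : B) ∈ nullSet B := by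
    rw [map_mul Ambient.of (v : B) (s * r * a'), map_mul Ambient.of (v : B) (s * t * b'),
      ← mul_add, ← hv]
    exact Ideal.mul_mem_left _ _ (Ideal.mul_mem_left _ _ hy)
  have h3 : (v * (s * t * b') : B) = neg 1 * (v * (s * r * a')) := by
    rw [eq_neg_of_mem h2, neg_mul', one_mul]
  have h4 := congrArg (ι S) h3
  simp only [map_mul, ← ha, ← hb] at h4
  have hu : IsUnit (ι S v * ι S s * ι S t * ι S r) :=
    (((isUnit_ι S v).mul (isUnit_ι S s)).mul (isUnit_ι S t)).mul (isUnit_ι S r)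
  refine hu.mul_left_cancel ?_
  calc _ = ι S v * (ι S s * ι S t * (ι S r * b)) := by ac_rfl
    _ = _ := h4
    _ = _ := by ac_rfl

/-- The localization `S⁻¹B` of a band; its null set is the ideal of `(S⁻¹B)⁺` generated by the sums
`∑ aᵢ / 1` for `∑ aᵢ` in the null set of `B`. -/
instance : Band (Localization S) where
  nullSet := Ideal.map (Ambient.map (ι S)) (nullSet B)
  existsUnique_neg a := by
    refine ⟨ι S (neg 1) * a, ?_, fun b hb => eq_of_mem S hb⟩
    have h : Ambient.of a + Ambient.of (ι S (neg 1) * a) =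
        Ambient.of a * Ambient.map (ι S) (Ambient.of 1 + Ambient.of (neg 1)) := by
      simp only [map_add, Ambient.map_of, map_mul, map_one]
      ring
    simp only [h]
    exact Ideal.mul_mem_left _ _ (Ideal.mem_map_of_mem _ (add_neg_mem 1))

/-- The localization map `B → S⁻¹B`. -/
def ιHom : BandHom B (Localization S) where
  toMonoidWithZeroHom := ι S
  map_null' _ hx := Ideal.mem_map_of_mem _ hx

lemma ιHom_apply (a : B) : ιHom S a = Localization.mk a 1 := rfl

variable {S}

/-- The universal property of the localization. -/
def lift {C : Type v} [Band C] (f : BandHom B C) (hf : ∀ s : S, IsUnit (f s)) :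
    BandHom (Localization S) C where
  toMonoidWithZeroHom := (Localization.monoidOf S).lift₀ f.toMonoidWithZeroHom hf
  map_null' x hx := by
    revert x
    change Ideal.map (Ambient.map (ι S)) (nullSet B) ≤ (nullSet C).comap _
    rw [Ideal.map_le_iff_le_comap]
    intro x hx
    rw [Ideal.mem_comap, Ideal.mem_comap, Ambient.map_map]
    have : ((Localization.monoidOf S).lift₀ f.toMonoidWithZeroHom hf).comp (ι S) =
        f.toMonoidWithZeroHom := by
      ext b
      exact (Localization.monoidOf S).lift_eq hf b
    rw [this]
    exact f.map_null' x hx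

lemma lift_ι {C : Type v} [Band C] (f : BandHom B C) (hf : ∀ s : S, IsUnit (f s)) (b : B) :
    lift f hf (ιHom S b) = f b := (Localization.monoidOf S).lift_eq hf b

lemma ι_mul_mk (a : B) (s : S) : ιHom S s * Localization.mk a s = ιHom S a := by
  rw [ιHom_apply, ιHom_apply, Localization.mk_mul, Localization.mk_eq_mk_iff,
    Localization.r_iff_exists]
  exact ⟨1, by simp⟩

lemma isUnit_ιHom (s : S) : IsUnit (ιHom S s) := isUnit_ι S s

lemma eq_mk_iff (x : Localization S) (a : B) (s : S) :
    x = Localization.mk a s ↔ ιHom S s * x = ιHom S a := by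
  refine ⟨fun h => h ▸ ι_mul_mk a s, fun h => (isUnit_ιHom s).mul_left_cancel ?_⟩
  rw [h, ι_mul_mk]

lemma hom_ext {C : Type v} [Band C] {f g : BandHom (Localization S) C}
    (h : ∀ b, f (ιHom S b) = g (ιHom S b)) : f = g := by
  ext x
  obtain ⟨s, a, hx⟩ := exists_ι_mul S x
  change ιHom S s * x = ιHom S a at hx
  have hu : IsUnit (f (ιHom S s)) := (isUnit_ιHom s).map f
  refine hu.mul_left_cancel ?_
  rw [← map_mul, hx, h s, ← map_mul, hx, h]

end Loc

/-! ### The prime spectrum -/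

/-- An `m`-ideal of a band. -/
structure IsMIdeal {B : Type u} [Band B] (I : Set B) : Prop where
  zero_mem : (0 : B) ∈ I
  mul_mem : ∀ (b : B), ∀ a ∈ I, b * a ∈ I

/-- A prime `m`-ideal of a band: an `m`-ideal whose complement is a multiplicative subset. -/
@[ext]
structure PrimeMIdeal (B : Type u) [Band B] where
  /-- The underlying set. -/
  carrier : Set B
  isMIdeal : IsMIdeal carrier
  one_mem_compl : (1 : B) ∈ carrierᶜ
  mul_mem_compl : ∀ {a b : B}, a ∈ carrierᶜ → b ∈ carrierᶜ → a * b ∈ carrierᶜ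

namespace PrimeMIdeal

variable {B : Type u} [Band B] {C : Type v} [Band C]

/-- The complement of a prime `m`-ideal as a submonoid. -/
def compl (p : PrimeMIdeal B) : Submonoid B where
  carrier := p.carrierᶜ
  one_mem' := p.one_mem_compl
  mul_mem' := p.mul_mem_compl

/-- The localization `B_𝔭` at a prime `m`-ideal. -/
abbrev Localized (p : PrimeMIdeal B) : Type u := Localization p.compl

/-- The principal open subset `U_h`, as a set. -/
def basicSet (h : B) : Set (PrimeMIdeal B) := {p | h ∉ p.carrier}

/-- The topology on the spectrum is generated by the principal open subsets. -/
instance : TopologicalSpace (PrimeMIdeal B) :=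
  TopologicalSpace.generateFrom (Set.range basicSet)

/-- The principal open subset `U_h`. -/
def basicOpen (h : B) : Opens (PrimeMIdeal B) :=
  ⟨basicSet h, TopologicalSpace.isOpen_generateFrom_of_mem ⟨h, rfl⟩⟩

lemma mem_basicOpen {h : B} {p : PrimeMIdeal B} : p ∈ basicOpen h ↔ h ∉ p.carrier := Iff.rfl

/-- The inverse image of a prime `m`-ideal under a band morphism. -/
def comap (f : BandHom B C) (q : PrimeMIdeal C) : PrimeMIdeal B where
  carrier := f ⁻¹' q.carrier
  isMIdeal :=
    { zero_mem := by rw [Set.mem_preimage, map_zero]; exact q.isMIdeal.zero_mem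
      mul_mem := fun b a ha => by
        rw [Set.mem_preimage, map_mul]; exact q.isMIdeal.mul_mem _ _ ha }
  one_mem_compl := by
    rw [Set.mem_compl_iff, Set.mem_preimage, map_one]; exact q.one_mem_compl
  mul_mem_compl {a b} ha hb := by
    rw [Set.mem_compl_iff, Set.mem_preimage, map_mul]; exact q.mul_mem_compl ha hb

lemma continuous_comap (f : BandHom B C) : Continuous (comap f) := by
  refine continuous_generateFrom_iff.2 ?_
  rintro _ ⟨h, rfl⟩
  exact (basicOpen (f h)).isOpen

/-- The morphism `B_{f⁻¹(𝔮)} → C_𝔮` induced by `f : B → C`. -/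
def localMap (f : BandHom B C) (q : PrimeMIdeal C) :
    BandHom (comap f q).Localized q.Localized :=
  Loc.lift ((Loc.ιHom q.compl).comp f) fun s => Loc.isUnit_ιHom (⟨f s, s.2⟩ : q.compl)

lemma localMap_ι (f : BandHom B C) (q : PrimeMIdeal C) (b : B) :
    localMap f q (Loc.ιHom _ b) = Loc.ιHom _ (f b) := Loc.lift_ι _ _ b

lemma localMap_mk (f : BandHom B C) (q : PrimeMIdeal C) (a : B) (g : (comap f q).compl) :
    localMap f q (Localization.mk a g) = Localization.mk (f a) (⟨f g, g.2⟩ : q.compl) := by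
  rw [Loc.eq_mk_iff, ← localMap_ι, ← localMap_ι f q a, ← map_mul, Loc.ι_mul_mk]

end PrimeMIdeal

/-! ### The structure sheaf -/

section Sections

open PrimeMIdeal

variable {B : Type u} [Band B]

/-- A family of elements of the localizations `B_𝔭`, for `𝔭` in an open set `U`, is locally a
fraction if each point of `U` has an open neighbourhood on which it is given by one fraction. -/
def IsLocallyFraction {U : Opens (PrimeMIdeal B)} (s : ∀ p : U, p.1.Localized) : Prop :=
  ∀ p : U, ∃ V : Opens (PrimeMIdeal B), p.1 ∈ V ∧ ∃ a g : B,
    ∀ q : U, q.1 ∈ V → ∃ hg : g ∈ q.1.compl, s q = Localization.mk a ⟨g, hg⟩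

/-- The sections of the structure sheaf over an open set `U` of the spectrum. -/
structure Sections (U : Opens (PrimeMIdeal B)) : Type u where
  /-- The underlying family. -/
  val : ∀ p : U, p.1.Localized
  prop : IsLocallyFraction val

namespace Sections

variable {U V : Opens (PrimeMIdeal B)}

lemma ext {s t : Sections U} (h : ∀ p, s.1 p = t.1 p) : s = t := by
  cases s; cases t; congr; exact funext h

/-- The section given by an element of `B`. -/
def const (U : Opens (PrimeMIdeal B)) (a : B) : Sections U :=
  ⟨fun _ => Loc.ιHom _ a, fun _ => ⟨⊤, trivial, a, 1, fun q _ => ⟨q.1.one_mem_compl, rfl⟩⟩⟩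

instance : Mul (Sections U) where
  mul s t := ⟨fun p => s.1 p * t.1 p, fun p => by
    obtain ⟨V, hV, a, g, h⟩ := s.2 p
    obtain ⟨W, hW, b, k, h'⟩ := t.2 p
    refine ⟨V ⊓ W, ⟨hV, hW⟩, a * b, g * k, fun q hq => ?_⟩
    obtain ⟨hg, hs⟩ := h q hq.1
    obtain ⟨hk, ht⟩ := h' q hq.2
    refine ⟨q.1.mul_mem_compl hg hk, ?_⟩
    change s.1 q * t.1 q = _
    rw [hs, ht, Localization.mk_mul]
    rfl⟩

instance : Zero (Sections U) := ⟨const U 0⟩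

instance : One (Sections U) := ⟨const U 1⟩

lemma mul_val (s t : Sections U) (p : U) : (s * t).1 p = s.1 p * t.1 p := rfl

lemma zero_val (p : U) : (0 : Sections U).1 p = 0 := map_zero (Loc.ιHom p.1.compl)

lemma one_val (p : U) : (1 : Sections U).1 p = 1 := map_one (Loc.ιHom p.1.compl)

instance : CommMonoidWithZero (Sections U) where
  mul_assoc _ _ _ := Sections.ext fun _ => mul_assoc _ _ _
  mul_comm _ _ := Sections.ext fun _ => mul_comm _ _
  one_mul s := Sections.ext fun p => by rw [mul_val, one_val, one_mul]
  mul_one s := Sections.ext fun p => by rw [mul_val, one_val, mul_one]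
  zero_mul s := Sections.ext fun p => by rw [mul_val, zero_val, zero_mul]
  mul_zero s := Sections.ext fun p => by rw [mul_val, zero_val, mul_zero]

/-- The value of a section at a point, as a morphism of pointed monoids. -/
def evalMonoid (p : U) : Sections U →*₀ p.1.Localized where
  toFun s := s.1 p
  map_zero' := zero_val p
  map_one' := one_val p
  map_mul' _ _ := rfl

/-- A formal sum of sections is null if it is null at each point. -/
instance : Band (Sections U) where
  nullSet := ⨅ p : U, (nullSet p.1.Localized).comap (Ambient.map (evalMonoid p))
  existsUnique_neg s := by
    refine ⟨const U (neg 1) * s, ?_, fun t ht => ?_⟩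
    · simp only [Ideal.mem_iInf, Ideal.mem_comap, map_add, Ambient.map_of]
      intro p
      have : evalMonoid p (const U (neg 1) * s) = neg (s.1 p) := by
        change Loc.ιHom p.1.compl (neg 1) * s.1 p = _
        rw [map_neg, neg_mul', map_one, one_mul]
      rw [this]
      exact add_neg_mem _
    · simp only [Ideal.mem_iInf, Ideal.mem_comap, map_add, Ambient.map_of] at ht
      refine Sections.ext fun p => ?_
      change t.1 p = Loc.ιHom p.1.compl (neg 1) * s.1 p
      rw [map_neg, neg_mul', map_one, one_mul]
      exact eq_neg_of_mem (ht p)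

/-- The value of a section at a point. -/
def eval (p : U) : BandHom (Sections U) p.1.Localized where
  toMonoidWithZeroHom := evalMonoid p
  map_null' _ hx := Ideal.mem_comap.1 (Ideal.mem_iInf.1 hx p)

lemma eval_apply (p : U) (s : Sections U) : eval p s = s.1 p := rfl

/-- Band morphisms into the sections. -/
def homMk {E : Type v} [Band E] (f : ∀ p : U, BandHom E p.1.Localized)
    (hf : ∀ e, IsLocallyFraction fun p => f p e) : BandHom E (Sections U) where
  toFun e := ⟨fun p => f p e, hf e⟩
  map_zero' := Sections.ext fun p => (map_zero (f p)).trans (zero_val p).symm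
  map_one' := Sections.ext fun p => (map_one (f p)).trans (one_val p).symm
  map_mul' a b := Sections.ext fun p => map_mul (f p) a b
  map_null' x hx := by
    refine Ideal.mem_iInf.2 fun p => Ideal.mem_comap.2 ?_
    rw [Ambient.map_map]
    exact (f p).map_null' x hx

/-- The restriction of sections. -/
def res (h : V ≤ U) : BandHom (Sections U) (Sections V) :=
  homMk (fun p => eval (⟨p.1, h p.2⟩ : U)) fun s p => by
    obtain ⟨W, hW, a, g, hs⟩ := s.2 ⟨p.1, h p.2⟩
    exact ⟨W, hW, a, g, fun q hq => hs ⟨q.1, h q.2⟩ hq⟩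

lemma res_val (h : V ≤ U) (s : Sections U) (p : V) : (res h s).1 p = s.1 ⟨p.1, h p.2⟩ := rfl

/-- The canonical morphism from `B` to the sections over an open set. -/
def constHom (U : Opens (PrimeMIdeal B)) : BandHom B (Sections U) :=
  homMk (fun p => Loc.ιHom p.1.compl) fun a => (const U a).2

end Sections

end Sections

/-- The underlying topological space of the spectrum of a band. -/
abbrev specTop (B : BandCat.{u}) : TopCat.{u} := TopCat.of (PrimeMIdeal B)

/-- The structure presheaf on the spectrum of a band. -/
def structurePresheaf (B : BandCat.{u}) : (specTop B).Presheaf BandCat.{u} where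
  obj U := BandCat.of (Sections (B := B) U.unop)
  map i := BandCat.ofHom (Sections.res (B := B) (leOfHom i.unop))

theorem structurePresheaf_isSheaf (B : BandCat.{u}) : (structurePresheaf B).IsSheaf := by
  intro E U S hS x hx
  have hS' : ∀ p : U, ∃ (V : Opens (PrimeMIdeal B)) (f : V ⟶ U), S f ∧ p.1 ∈ V :=
    fun p => hS p.1 p.2
  choose V f hf hp using hS'
  let y (W : Opens (PrimeMIdeal B)) (g : W ⟶ U) (hg : S g) :
      BandHom E (Sections (B := B) W) := BandCat.hom (x g hg)
  have key : ∀ (W : Opens (PrimeMIdeal B)) (g : W ⟶ U) (hg : S g)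
      (W' : Opens (PrimeMIdeal B)) (g' : W' ⟶ U) (hg' : S g') (p : PrimeMIdeal B)
      (hW : p ∈ W) (hW' : p ∈ W') (e : E), (y W g hg e).1 ⟨p, hW⟩ = (y W' g' hg' e).1 ⟨p, hW'⟩ := by
    intro W g hg W' g' hg' p hW hW' e
    have h := hx (Y₁ := W) (Y₂ := W') (Z := W ⊓ W') (homOfLE inf_le_left) (homOfLE inf_le_right)
      hg hg' (Subsingleton.elim _ _)
    replace h : x g hg ≫ (structurePresheaf B).map (homOfLE inf_le_left).op =
        x g' hg' ≫ (structurePresheaf B).map (homOfLE inf_le_right).op := h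
    have h' : (Sections.res (inf_le_left : W ⊓ W' ≤ W)).comp (y W g hg) =
        (Sections.res (inf_le_right : W ⊓ W' ≤ W')).comp (y W' g' hg') := congrArg BandCat.hom h
    have h'' := congrArg (fun s : Sections (W ⊓ W') => s.1 ⟨p, hW, hW'⟩) (DFunLike.congr_fun h' e)
    exact h''
  let t : BandHom E (Sections (B := B) U) :=
    Sections.homMk (fun p => (Sections.eval ⟨p.1, hp p⟩).comp (y (V p) (f p) (hf p)))
      fun e p => by
        obtain ⟨W, hW, a, g, h⟩ := (y (V p) (f p) (hf p) e).2 ⟨p.1, hp p⟩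
        refine ⟨W ⊓ V p, ⟨hW, hp p⟩, a, g, fun q hq => ?_⟩
        obtain ⟨hg, h⟩ := h ⟨q.1, hq.2⟩ hq.1
        refine ⟨hg, ?_⟩
        refine Eq.trans ?_ h
        exact key _ _ _ _ _ _ _ _ _ _
  refine ⟨BandCat.ofHom t, ?_, ?_⟩
  · intro W g hg
    apply ConcreteCategory.hom_ext
    intro e
    refine Sections.ext (B := B) fun p => ?_
    exact key _ (f ⟨p.1, leOfHom g p.2⟩) (hf _) W g hg p.1 (hp ⟨p.1, leOfHom g p.2⟩) p.2 e
  · intro t' ht'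
    apply ConcreteCategory.hom_ext
    intro e
    refine Sections.ext (B := B) fun p => ?_
    have h := ConcreteCategory.congr_hom (ht' (f p) (hf p)) e
    have h' := congrArg (fun s : Sections (B := B) (V p) => s.1 ⟨p.1, hp p⟩) h
    exact h'

/-- The spectrum of a band as a sheafed space. -/
def specSheafed (B : BandCat.{u}) : AlgebraicGeometry.SheafedSpace BandCat.{u} where
  carrier := specTop B
  presheaf := structurePresheaf B
  IsSheaf := structurePresheaf_isSheaf B

/-! ### Band spaces -/

/-- A band space: a topological space with a sheaf of bands. -/
structure BandSpace : Type (u + 1) where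
  /-- The underlying sheafed space. -/
  toSheafedSpace : AlgebraicGeometry.SheafedSpace BandCat.{u}

namespace BandSpace

open AlgebraicGeometry

/-- A morphism of sheafed spaces `f` is local if the induced morphisms of stalks map non-units to
non-units. -/
def IsLocal {X Y : SheafedSpace BandCat.{u}} (f : X ⟶ Y) : Prop :=
  ∀ (x : X) (a : Y.presheaf.stalk (f.hom.base x)), ¬ IsUnit a → ¬ IsUnit (f.hom.stalkMap x a)

/-- A morphism of band spaces: a continuous map together with a local morphism of sheaves. -/
@[ext]
structure Hom (X Y : BandSpace.{u}) where
  /-- The underlying morphism of sheafed spaces. -/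
  toShHom : X.toSheafedSpace ⟶ Y.toSheafedSpace
  isLocal : IsLocal toShHom

lemma isLocal_of_isIso {X Y : SheafedSpace BandCat.{u}} (f : X ⟶ Y) [IsIso f] : IsLocal f := by
  intro x a ha h
  have : IsIso (f.hom.stalkMap x) := inferInstance
  apply ha
  have h' := h.map (BandCat.hom (inv (f.hom.stalkMap x)))
  have e : BandCat.hom (inv (f.hom.stalkMap x)) (f.hom.stalkMap x a) = a :=
    ConcreteCategory.congr_hom (IsIso.hom_inv_id (f.hom.stalkMap x)) a
  rwa [e] at h'

lemma isLocal_comp {X Y Z : SheafedSpace BandCat.{u}} {f : X ⟶ Y} {g : Y ⟶ Z} (hf : IsLocal f)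
    (hg : IsLocal g) : IsLocal (f ≫ g) := by
  intro x a ha h
  refine hf x _ (hg (f.hom.base x) a ha) ?_
  have e := ConcreteCategory.congr_hom (PresheafedSpace.stalkMap.comp f.hom g.hom x) a
  exact e ▸ h

instance : Category BandSpace.{u} where
  Hom := Hom
  id X := ⟨𝟙 X.toSheafedSpace, isLocal_of_isIso _⟩
  comp f g := ⟨f.toShHom ≫ g.toShHom, isLocal_comp f.isLocal g.isLocal⟩

lemma hom_ext {X Y : BandSpace.{u}} {f g : X ⟶ Y} (h : f.toShHom = g.toShHom) : f = g :=
  Hom.ext h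

/-- An isomorphism of sheafed spaces gives an isomorphism of band spaces. -/
def isoMk {X Y : BandSpace.{u}} (e : X.toSheafedSpace ≅ Y.toSheafedSpace) : X ≅ Y where
  hom := ⟨e.hom, isLocal_of_isIso _⟩
  inv := ⟨e.inv, isLocal_of_isIso _⟩
  hom_inv_id := hom_ext e.hom_inv_id
  inv_hom_id := hom_ext e.inv_hom_id

/-- The band space given by an open subset of a band space. -/
def restrict (X : BandSpace.{u}) (U : Opens X.toSheafedSpace) : BandSpace.{u} :=
  ⟨X.toSheafedSpace.restrict U.isOpenEmbedding⟩

/-- The global sections of band spaces, `X ↦ 𝒪_X(X)`. -/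
def Γ : BandSpace.{u}ᵒᵖ ⥤ BandCat.{u} where
  obj X := X.unop.toSheafedSpace.presheaf.obj (op ⊤)
  map f := f.unop.toShHom.hom.c.app (op ⊤)

end BandSpace

/-! ### The functor `Spec` -/

section Spec

open AlgebraicGeometry PrimeMIdeal

/-- The pull back of sections along the map of spectra induced by a band morphism. -/
def Sections.comap {B C : Type u} [Band B] [Band C] (f : BandHom B C)
    (U : Opens (PrimeMIdeal B)) (V : Opens (PrimeMIdeal C))
    (h : ∀ q ∈ V, PrimeMIdeal.comap f q ∈ U) : BandHom (Sections U) (Sections V) :=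
  Sections.homMk (fun q => (localMap f q.1).comp (Sections.eval ⟨PrimeMIdeal.comap f q.1, h _ q.2⟩))
    fun s q => by
      obtain ⟨W, hW, a, g, hs⟩ := s.2 ⟨PrimeMIdeal.comap f q.1, h _ q.2⟩
      refine ⟨⟨PrimeMIdeal.comap f ⁻¹' W, W.isOpen.preimage (continuous_comap f)⟩, hW, f a, f g,
        fun r hr => ?_⟩
      obtain ⟨hg, hs⟩ := hs ⟨PrimeMIdeal.comap f r.1, h _ r.2⟩ hr
      refine ⟨hg, ?_⟩
      refine (congrArg (localMap f r.1) hs).trans ?_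
      exact localMap_mk f r.1 a ⟨g, hg⟩

lemma Sections.comap_val {B C : Type u} [Band B] [Band C] (f : BandHom B C)
    (U : Opens (PrimeMIdeal B)) (V : Opens (PrimeMIdeal C))
    (h : ∀ q ∈ V, PrimeMIdeal.comap f q ∈ U) (s : Sections U) (q : V) :
    (Sections.comap f U V h s).1 q = localMap f q.1 (s.1 ⟨PrimeMIdeal.comap f q.1, h _ q.2⟩) := rfl

/-- The morphism of sheafed spaces `Spec C ⟶ Spec B` induced by a band morphism `B ⟶ C`. -/
def specMap {B C : BandCat.{u}} (f : B ⟶ C) : specSheafed C ⟶ specSheafed B :=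
  InducedCategory.homMk
    { base := TopCat.ofHom ⟨PrimeMIdeal.comap (BandCat.hom f), continuous_comap _⟩
      c :=
        { app := fun U => BandCat.ofHom (Sections.comap (BandCat.hom f) U.unop _ fun _ h => h)
          naturality := fun _ _ _ => rfl } }

/-- The evaluation of germs at a point of the spectrum. -/
def stalkEval {B : BandCat.{u}} (p : PrimeMIdeal B) :
    (structurePresheaf B).stalk p ⟶ BandCat.of p.Localized :=
  colimit.desc ((OpenNhds.inclusion (X := specTop B) p).op ⋙ structurePresheaf B)
    { pt := BandCat.of p.Localized
      ι :=
        { app := fun U => BandCat.ofHom (Sections.eval (⟨p, U.unop.2⟩ : U.unop.1))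
          naturality := fun _ _ _ => rfl } }

lemma stalkEval_germ {B : BandCat.{u}} (p : PrimeMIdeal B) (U : Opens (PrimeMIdeal B))
    (hp : p ∈ U) (s : Sections U) :
    stalkEval p ((structurePresheaf B).germ U p hp s) = s.1 ⟨p, hp⟩ :=
  ConcreteCategory.congr_hom (colimit.ι_desc
    (F := (OpenNhds.inclusion (X := specTop B) p).op ⋙ structurePresheaf B) _ (op ⟨U, hp⟩)) s

lemma mem_compl_of_isUnit {B : Type u} [Band B] (p : PrimeMIdeal B) (a : B) (s : p.compl)
    (h : IsUnit (Localization.mk a s : p.Localized)) : a ∈ p.compl := by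
  intro ha
  have h1 : IsUnit (Loc.ιHom p.compl a) := by
    rw [← Loc.ι_mul_mk a s]
    exact (Loc.isUnit_ιHom s).mul h
  obtain ⟨y, hy⟩ := h1.exists_right_inv
  obtain ⟨t, c, hc⟩ := Loc.exists_ι_mul p.compl y
  change Loc.ιHom p.compl t * y = Loc.ιHom p.compl c at hc
  have h2 : Loc.ιHom p.compl (a * c) = Loc.ιHom p.compl t := by
    rw [map_mul, ← hc, mul_left_comm, hy, mul_one]
  obtain ⟨v, hv⟩ := (Localization.monoidOf p.compl).exists_of_eq h2
  refine (v * t).2 ?_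
  change (v * t : B) ∈ p.carrier
  rw [← hv, mul_comm a c]
  exact p.isMIdeal.mul_mem _ _ (p.isMIdeal.mul_mem _ _ ha)

lemma mul_mk_eq_one {B : Type u} [Band B] (p : PrimeMIdeal B) (a g : B) (ha : a ∈ p.compl)
    (hg : g ∈ p.compl) :
    (Localization.mk a ⟨g, hg⟩ : p.Localized) * Localization.mk g ⟨a, ha⟩ = 1 := by
  rw [Localization.mk_mul, ← Localization.mk_one, Localization.mk_eq_mk_iff,
    Localization.r_iff_exists]
  exact ⟨1, by simp [mul_comm]⟩

lemma isUnit_germ {B : BandCat.{u}} (p : PrimeMIdeal B) (U : Opens (PrimeMIdeal B)) (hp : p ∈ U)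
    (s : Sections U) (h : IsUnit (s.1 ⟨p, hp⟩)) :
    IsUnit ((structurePresheaf B).germ U p hp s) := by
  obtain ⟨W, hW, a, g, hs⟩ := s.2 ⟨p, hp⟩
  have ha : a ∈ p.compl := by
    obtain ⟨hg, hs⟩ := hs ⟨p, hp⟩ hW
    rw [hs] at h
    exact mem_compl_of_isUnit p a _ h
  let V : Opens (PrimeMIdeal B) := U ⊓ W ⊓ basicOpen a
  have hV : p ∈ V := ⟨⟨hp, hW⟩, ha⟩
  have hVU : V ≤ U := fun q hq => hq.1.1
  let t : Sections V :=
    ⟨fun r => Localization.mk g ⟨a, r.2.2⟩, fun r => ⟨V, r.2, g, a, fun q hq => ⟨hq.2, rfl⟩⟩⟩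
  have hst : Sections.res hVU s * t = 1 := by
    refine Sections.ext fun r => ?_
    obtain ⟨hg, hs⟩ := hs ⟨r.1, hVU r.2⟩ r.2.1.2
    rw [Sections.one_val, Sections.mul_val, Sections.res_val, hs]
    exact mul_mk_eq_one r.1 a g r.2.2 hg
  have e : (structurePresheaf B).germ V p hV (Sections.res hVU s) =
      (structurePresheaf B).germ U p hp s :=
    ConcreteCategory.congr_hom ((structurePresheaf B).germ_res (homOfLE hVU) p hV) s
  rw [← e]
  exact (IsUnit.of_mul_eq_one _ hst).map (BandCat.hom ((structurePresheaf B).germ V p hV))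

lemma isLocal_specMap {B C : BandCat.{u}} (f : B ⟶ C) : BandSpace.IsLocal (specMap f) := by
  intro (q : PrimeMIdeal C) a ha h
  apply ha
  obtain ⟨U, hU, s, rfl⟩ := exists_germ_eq (structurePresheaf B) _ a
  have h1 := h.map (BandCat.hom (stalkEval (B := C) q))
  have e1 : (specMap f).hom.stalkMap q ((structurePresheaf B).germ U _ hU s) =
      (structurePresheaf C).germ ((Opens.map (specMap f).hom.base).obj U) q hU
        (Sections.comap (BandCat.hom f) U _ (fun _ h => h) s) :=
    ConcreteCategory.congr_hom (PresheafedSpace.stalkMap_germ (specMap f).hom U q hU) s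
  have e2 := stalkEval_germ (B := C) q ((Opens.map (specMap f).hom.base).obj U) hU
    (Sections.comap (BandCat.hom f) U _ (fun _ h => h) s)
  have h2 : IsUnit (localMap (BandCat.hom f) q (s.1 ⟨PrimeMIdeal.comap (BandCat.hom f) q, hU⟩)) := by
    have e3 : (BandCat.hom (stalkEval (B := C) q))
        ((specMap f).hom.stalkMap q ((structurePresheaf B).germ U _ hU s)) =
        localMap (BandCat.hom f) q (s.1 ⟨PrimeMIdeal.comap (BandCat.hom f) q, hU⟩) :=
      (congrArg (BandCat.hom (stalkEval (B := C) q)) e1).trans e2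
    exact e3 ▸ h1
  refine isUnit_germ (B := B) _ U hU s ?_
  obtain ⟨W, hW, a, g, hs⟩ := s.2 ⟨PrimeMIdeal.comap (BandCat.hom f) q, hU⟩
  obtain ⟨hg, hs⟩ := hs _ hW
  rw [hs, localMap_mk] at h2
  have h3 := mem_compl_of_isUnit q _ _ h2
  refine hs ▸ ?_
  exact IsUnit.of_mul_eq_one _ (mul_mk_eq_one (PrimeMIdeal.comap (BandCat.hom f) q) a g h3 hg)

/-- The morphism from `B[h⁻¹]` to the sections of the structure sheaf over `U_h`. -/
def awayToSections {B : Type u} [Band B] (h : B) :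
    BandHom (Localization (Submonoid.powers h)) (Sections (basicOpen h)) :=
  Loc.lift (Sections.constHom (basicOpen h)) (by
    rintro ⟨_, n, rfl⟩
    simp only [map_pow]
    refine IsUnit.pow n ?_
    refine IsUnit.of_mul_eq_one
      ⟨fun p => Localization.mk 1 ⟨h, p.2⟩, fun p => ⟨⊤, trivial, 1, h, fun q _ => ⟨q.2, rfl⟩⟩⟩ ?_
    exact Sections.ext fun p => (Loc.ι_mul_mk (1 : B) (⟨h, p.2⟩ : p.1.compl)).trans
      ((map_one (Loc.ιHom p.1.compl)).trans (Sections.one_val p).symm))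

lemma comap_id {B : Type u} [Band B] (p : PrimeMIdeal B) : comap (BandHom.id B) p = p := rfl

lemma localMap_id {B : Type u} [Band B] (p : PrimeMIdeal B) (x : p.Localized) :
    localMap (BandHom.id B) p x = x := by
  have h : localMap (BandHom.id B) p = BandHom.id p.Localized :=
    Loc.hom_ext fun b => localMap_ι (BandHom.id B) p b
  exact DFunLike.congr_fun h x

lemma localMap_comp {A B C : Type u} [Band A] [Band B] [Band C] (f : BandHom A B)
    (g : BandHom B C) (p : PrimeMIdeal C) (x : (comap f (comap g p)).Localized) :
    localMap (g.comp f) p x = localMap g p (localMap f (comap g p) x) := by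
  have h : localMap (g.comp f) p = (localMap g p).comp (localMap f (comap g p)) := by
    refine Loc.hom_ext fun b => (localMap_ι (g.comp f) p b).trans ?_
    exact ((congrArg (localMap g p) (localMap_ι f (comap g p) b)).trans
      (localMap_ι g p (f b))).symm
  exact DFunLike.congr_fun h x

/-- Morphisms out of a spectrum are equal if they agree on points and on sections. -/
lemma spec_hom_ext {X : SheafedSpace BandCat.{u}} {B : BandCat.{u}} {α β : specSheafed B ⟶ X}
    (h : α.hom.base = β.hom.base)
    (hc : ∀ (U : Opens X) (s : X.presheaf.obj (op U)) (p : PrimeMIdeal B)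
      (hα : p ∈ (Opens.map α.hom.base).obj U) (hβ : p ∈ (Opens.map β.hom.base).obj U),
      Sections.val (B := B) (α.hom.c.app (op U) s) ⟨p, hα⟩ =
        Sections.val (B := B) (β.hom.c.app (op U) s) ⟨p, hβ⟩) : α = β := by
  refine InducedCategory.hom_ext (PresheafedSpace.ext _ _ h ?_)
  refine NatTrans.ext (funext fun U => ConcreteCategory.hom_ext _ _ fun s => ?_)
  rw [NatTrans.comp_app, Functor.whiskerRight_app, eqToHom_app]
  exact Sections.ext (B := B) fun p => hc U.unop s p.1 _ p.2

lemma specMap_id (B : BandCat.{u}) : specMap (𝟙 B) = 𝟙 (specSheafed B) := by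
  refine spec_hom_ext ?_ ?_
  · refine TopCat.hom_ext (ContinuousMap.ext fun p => ?_)
    exact comap_id p
  · intro U s p hα hβ
    exact localMap_id p _

lemma specMap_comp {A B C : BandCat.{u}} (f : A ⟶ B) (g : B ⟶ C) :
    specMap (f ≫ g) = specMap g ≫ specMap f := by
  refine spec_hom_ext ?_ ?_
  · exact TopCat.hom_ext (ContinuousMap.ext fun p => rfl)
  · intro U s p hα hβ
    exact localMap_comp (BandCat.hom f) (BandCat.hom g) p _

lemma awayToSections_ι {B : Type u} [Band B] (h b : B) :
    awayToSections h (Loc.ιHom _ b) = Sections.constHom _ b := Loc.lift_ι _ _ b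

lemma pow_mem_compl {B : Type u} [Band B] {p : PrimeMIdeal B} {h : B} (hp : h ∈ p.compl) (n : ℕ) :
    h ^ n ∈ p.compl := pow_mem hp n

lemma mem_compl_of_dvd {B : Type u} [Band B] {p : PrimeMIdeal B} {a b : B} (h : a ∣ b)
    (hb : b ∈ p.compl) : a ∈ p.compl := by
  obtain ⟨c, rfl⟩ := h
  exact fun ha => hb (mul_comm a c ▸ p.isMIdeal.mul_mem c a ha)

/-- If `h` is not nilpotent, the elements that divide no power of `h` form a prime `m`-ideal. -/
def notDvdPow {B : Type u} [Band B] (h : B) (hh : ∀ n, h ^ n ≠ 0) : PrimeMIdeal B where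
  carrier := {a | ∀ n, ¬ a ∣ h ^ n}
  isMIdeal :=
    { zero_mem := fun n hn => hh n (zero_dvd_iff.1 hn)
      mul_mem := fun b _ ha n hn => ha n ((Dvd.intro_left b rfl).trans hn) }
  one_mem_compl := fun h1 => h1 0 (one_dvd _)
  mul_mem_compl {a b} ha hb := by
    simp only [Set.mem_compl_iff, Set.mem_ofPred_eq, not_forall, not_not] at ha hb ⊢
    obtain ⟨n, hn⟩ := ha
    obtain ⟨m, hm⟩ := hb
    exact ⟨n + m, pow_add h n m ▸ mul_dvd_mul hn hm⟩

lemma mem_compl_notDvdPow {B : Type u} [Band B] {h : B} {hh : ∀ n, h ^ n ≠ 0} {a : B} :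
    a ∈ (notDvdPow h hh).compl ↔ ∃ n, a ∣ h ^ n := by
  change ¬ (∀ n, ¬ a ∣ h ^ n) ↔ _
  simp

lemma basicOpen_le {B : Type u} [Band B] (h : B) (hh : ∀ n, h ^ n ≠ 0) (V : Opens (PrimeMIdeal B))
    (hV : notDvdPow h hh ∈ V) : basicOpen h ≤ V := by
  intro q hq
  obtain ⟨V, hVo⟩ := V
  change notDvdPow h hh ∈ V at hV
  change q ∈ V
  induction hVo with
  | basic s hs =>
    obtain ⟨a, rfl⟩ := hs
    obtain ⟨n, hn⟩ := mem_compl_notDvdPow.1 hV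
    exact mem_compl_of_dvd hn (pow_mem_compl hq n)
  | univ => trivial
  | inter s t _ _ hs ht => exact ⟨hs hV.1, ht hV.2⟩
  | sUnion S _ ih =>
    obtain ⟨s, hs, hps⟩ := hV
    exact ⟨s, hs, ih s hs hps⟩

/-- The structure sheaf takes the value `B[h⁻¹]` on `U_h`. -/
theorem isIso_awayToSections {B : Type u} [Band B] (h : B) :
    IsIso (BandCat.ofHom (awayToSections h)) := by
  suffices H : ∃ g : BandHom (Sections (basicOpen h)) (Localization (Submonoid.powers h)),
      (∀ x, g (awayToSections h x) = x) ∧ ∀ s, awayToSections h (g s) = s by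
    obtain ⟨g, h1, h2⟩ := H
    exact ⟨BandCat.ofHom g, ConcreteCategory.hom_ext _ _ h1, ConcreteCategory.hom_ext _ _ h2⟩
  by_cases hh : ∀ n, h ^ n ≠ 0
  · let p := notDvdPow h hh
    have hp : p ∈ basicOpen h := mem_compl_notDvdPow.2 ⟨1, by rw [pow_one]⟩
    let l : BandHom p.Localized (Localization (Submonoid.powers h)) :=
      Loc.lift (Loc.ιHom _) fun s => by
        obtain ⟨n, hn⟩ := mem_compl_notDvdPow.1 s.2
        exact isUnit_of_dvd_unit (map_dvd (Loc.ιHom (Submonoid.powers h)) hn)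
          (Loc.isUnit_ιHom (⟨h ^ n, n, rfl⟩ : Submonoid.powers h))
    have h1 : (l.comp (Sections.eval ⟨p, hp⟩)).comp (awayToSections h) = BandHom.id _ := by
      refine Loc.hom_ext fun b => ?_
      rw [BandHom.comp_apply, awayToSections_ι]
      exact Loc.lift_ι _ _ b
    refine ⟨l.comp (Sections.eval ⟨p, hp⟩), DFunLike.congr_fun h1, fun s => ?_⟩
    obtain ⟨V, hV, a, g, hs⟩ := s.2 ⟨p, hp⟩
    have hVU := basicOpen_le h hh V hV
    refine Sections.ext fun q => ?_
    obtain ⟨hg, hsp⟩ := hs ⟨p, hp⟩ hV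
    obtain ⟨hgq, hsq⟩ := hs q (hVU q.2)
    rw [hsq, Loc.eq_mk_iff]
    have e1 : Loc.ιHom _ g * l (s.1 ⟨p, hp⟩) = Loc.ιHom _ a := by
      have e2 : l (Loc.ιHom _ g) = Loc.ιHom _ g := Loc.lift_ι _ _ g
      have e3 : l (Loc.ιHom _ a) = Loc.ιHom _ a := Loc.lift_ι _ _ a
      rw [← e2, ← e3, ← map_mul, hsp]
      exact congrArg l (Loc.ι_mul_mk a (⟨g, hg⟩ : p.compl))
    have e4 := congrArg (awayToSections h) e1
    rw [map_mul, awayToSections_ι, awayToSections_ι] at e4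
    exact congrArg (fun t : Sections (basicOpen h) => t.1 q) e4
  · push Not at hh
    obtain ⟨n, hn⟩ := hh
    have h1 : Subsingleton (Localization (Submonoid.powers h)) :=
      (Localization.monoidOf (Submonoid.powers h)).subsingleton ⟨n, hn⟩
    have h2 (x : Ambient (Localization (Submonoid.powers h))) : x = 0 := by
      induction x using Ambient.induction with
      | zero => rfl
      | of_ b => rw [Subsingleton.elim b 0, map_zero]
      | add x y hx hy => rw [hx, hy, add_zero]
    refine ⟨⟨⟨⟨fun _ => 0, rfl⟩, Subsingleton.elim _ _, fun _ _ => Subsingleton.elim _ _⟩,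
      fun x _ => ?_⟩, fun _ => Subsingleton.elim _ _, fun s => Sections.ext fun q => ?_⟩
    · rw [h2 (Ambient.map _ x)]
      exact zero_mem _
    · exact absurd q.1.isMIdeal.zero_mem (hn ▸ pow_mem_compl q.2 n)

/-- The spectrum as a functor from bands to band spaces. -/
def specFunctor : BandCat.{u}ᵒᵖ ⥤ BandSpace.{u} where
  obj B := ⟨specSheafed B.unop⟩
  map f := ⟨specMap f.unop, isLocal_specMap f.unop⟩
  map_id B := BandSpace.hom_ext (specMap_id B.unop)
  map_comp f g := BandSpace.hom_ext (specMap_comp g.unop f.unop)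

end Spec

/-! ### Affine band schemes and band schemes -/

open AlgebraicGeometry

/-- Affine band schemes: the band spaces that are isomorphic to the spectrum of a band. -/
def isAffine : ObjectProperty BandSpace.{u} :=
  fun X => ∃ B : BandCat.{u}, Nonempty (X ≅ specFunctor.obj (op B))

/-- Band schemes: the band spaces in which every point has an open neighbourhood that is an affine
band scheme. -/
def isScheme : ObjectProperty BandSpace.{u} :=
  fun X => ∀ x : X.toSheafedSpace, ∃ U : Opens X.toSheafedSpace, x ∈ U ∧ isAffine (X.restrict U)

lemma isAffine_specFunctor (B : BandCat.{u}ᵒᵖ) : isAffine (specFunctor.obj B) :=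
  ⟨B.unop, ⟨Iso.refl _⟩⟩

lemma isAffine_le_isScheme : isAffine.{u} ≤ isScheme.{u} := by
  rintro X ⟨B, ⟨e⟩⟩ x
  exact ⟨⊤, trivial, B, ⟨BandSpace.isoMk X.toSheafedSpace.restrictTopIso ≪≫ e⟩⟩

/-- The category of affine band schemes. -/
abbrev BAff : Type (u + 1) := isAffine.{u}.FullSubcategory

/-- The category of band schemes. -/
abbrev BSch : Type (u + 1) := isScheme.{u}.FullSubcategory

/-- The inclusion of affine band schemes into band schemes. -/
def affineInclusion : BAff.{u} ⥤ BSch.{u} := ObjectProperty.ιOfLE isAffine_le_isScheme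

/-- The spectrum as a functor from bands to affine band schemes. -/
def SpecAff : BandCat.{u}ᵒᵖ ⥤ BAff.{u} := isAffine.lift specFunctor isAffine_specFunctor

/-- The spectrum as a functor from bands to band schemes. -/
def Spec : BandCat.{u}ᵒᵖ ⥤ BSch.{u} := SpecAff ⋙ affineInclusion

/-- The global sections of band schemes. -/
def Γ : BSch.{u}ᵒᵖ ⥤ BandCat.{u} := isScheme.ι.op ⋙ BandSpace.Γ

/-- The canonical morphism from `B` to the global sections of its spectrum. -/
def toΓSpec (B : BandCat.{u}) : B ⟶ Γ.obj (op (Spec.obj (op B))) :=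
  BandCat.ofHom (Sections.constHom ⊤)

/-- The map `Hom(X, Spec B) → Hom(B, Γ X)` that pulls back global sections. -/
def pullbackSections (X : BSch.{u}) (B : BandCat.{u}) (φ : X ⟶ Spec.obj (op B)) :
    B ⟶ Γ.obj (op X) :=
  toΓSpec B ≫ Γ.map φ.op

end Bands

end

noncomputable section

namespace Bands

open AlgebraicGeometry PrimeMIdeal

/-! ### Units in the structure sheaf of a spectrum -/

/-! The heart is the bijection `Hom(X, Spec B) → Hom(B, Γ X)`; the rest is formal once `B → Γ Spec
B` is known to be an isomorphism.

Being a prime `m`-ideal involves no addition, so the nonunits of any nontrivial band form one: every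
nontrivial stalk is automatically local. Hence `f : B → Γ X` sends a point `x` to the prime of those
`b` for which the germ of `f b` at `x` is not a unit. This map is continuous because units of stalks
spread to neighbourhoods, which is checked in affine charts, where sections are locally fractions
(`hasOpenUnits_of_isScheme`). For the sheaf part, the sections over `U_h` are `B[h⁻¹]`, so `f`
extends uniquely to them over any open set on which `f h` is a unit. The `U_h` form a basis and the
extensions do not depend on `h` (`map_liftBasicOpen`), so they glue (`ToSpec.exists_app`). Writing
sections near a point as fractions shows that the result is local (`ToSpec.isLocal_hom`).

Conversely, locality forces the map on points, and since `B → 𝒪(U_h)` is an epimorphism, the global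
sections force the map on sheaves (`hom_toSpec_ext`).

Finally, `U_1` is the whole spectrum and `B[1⁻¹]` is `B`, so the canonical map `B → Γ Spec B` is an
isomorphism. It is the counit of the adjunction, whence `Spec` is fully faithful. It is essentially
surjective onto affine band schemes by their definition, and the reflection is the adjunction
composed with the resulting equivalence. -/

lemma isUnit_of_isUnit_map {B C : BandCat.{u}} (f : B ⟶ C) [IsIso f] {b : B} (h : IsUnit (f b)) :
    IsUnit b := by
  have e : inv f (f b) = b := ConcreteCategory.congr_hom (IsIso.hom_inv_id f) b
  exact e ▸ h.map (BandCat.hom (inv f))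

/-- Localizing at `𝔭` inverts nothing inside `𝔭`: an inverse of `b / 1` with `b ∈ 𝔭` would put an
element of the complement into `𝔭`. This is the link between units and points. -/
lemma Loc.isUnit_ιHom_iff {B : Type u} [Band B] (p : PrimeMIdeal B) (b : B) :
    IsUnit (Loc.ιHom p.compl b) ↔ b ∈ p.compl :=
  ⟨mem_compl_of_isUnit p b 1, fun hb => Loc.isUnit_ιHom (⟨b, hb⟩ : p.compl)⟩

lemma PrimeMIdeal.zero_ne_one_localized {B : Type u} [Band B] (p : PrimeMIdeal B) :
    (0 : p.Localized) ≠ 1 := by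
  intro h
  refine (Loc.isUnit_ιHom_iff p 0).1 ?_ p.isMIdeal.zero_mem
  rw [map_zero, h]
  exact isUnit_one

/-- Evaluation at `p` preserves and detects units, so questions about units in the stalk move to
`B_𝔭` without identifying the two bands. -/
lemma isUnit_germ_iff {B : BandCat.{u}} (p : PrimeMIdeal B) (U : Opens (PrimeMIdeal B))
    (hp : p ∈ U) (s : Sections U) :
    IsUnit ((structurePresheaf B).germ U p hp s) ↔ IsUnit (s.1 ⟨p, hp⟩) :=
  ⟨fun h => stalkEval_germ p U hp s ▸ h.map (BandCat.hom (stalkEval p)), isUnit_germ p U hp s⟩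

/-- A section that is a unit at a point is a unit in a neighbourhood of this point. -/
lemma exists_isUnit_res {B : Type u} [Band B] (U : Opens (PrimeMIdeal B)) (s : Sections U) (p : U)
    (h : IsUnit (s.1 p)) :
    ∃ (V : Opens (PrimeMIdeal B)) (hVU : V ≤ U), p.1 ∈ V ∧ IsUnit (Sections.res hVU s) := by
  obtain ⟨W, hW, a, g, hs⟩ := s.2 p
  have ha : a ∈ p.1.compl := by
    obtain ⟨hg, hs⟩ := hs p hW
    rw [hs] at h
    exact mem_compl_of_isUnit p.1 a _ h
  -- Near `p` the section is `a / g`; its inverse is `g / a`, which makes sense at all primes that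
  -- omit `a`.
  refine ⟨U ⊓ W ⊓ basicOpen a, fun q hq => hq.1.1, ⟨⟨p.2, hW⟩, ha⟩,
    IsUnit.of_mul_eq_one ⟨fun r => Localization.mk g ⟨a, r.2.2⟩,
      fun r => ⟨U ⊓ W ⊓ basicOpen a, r.2, g, a, fun q hq => ⟨hq.2, rfl⟩⟩⟩ ?_⟩
  refine Sections.ext fun r => ?_
  obtain ⟨hg, hs⟩ := hs ⟨r.1, r.2.1.1⟩ r.2.1.2
  rw [Sections.one_val, Sections.mul_val, Sections.res_val, hs]
  exact mul_mk_eq_one r.1 a g r.2.2 hg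

/-! ### Units in the structure sheaf of a band scheme -/

/-- The stalks are nontrivial, and a section whose germ at a point is a unit is a unit in a
neighbourhood of this point. -/
structure HasOpenUnits (X : SheafedSpace BandCat.{u}) : Prop where
  zero_ne_one : ∀ x : X, (0 : X.presheaf.stalk x) ≠ 1
  exists_isUnit_map : ∀ (U : Opens X) (x : X) (hx : x ∈ U) (s : X.presheaf.obj (op U)),
    IsUnit (X.presheaf.germ U x hx s) →
      ∃ (V : Opens X) (i : V ⟶ U), x ∈ V ∧ IsUnit (X.presheaf.map i.op s)

/-- Charts are recast as open immersions from spectra, so that points, stalks and sections of `X`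
can be compared directly with those of `Spec A`. -/
lemma exists_chart {X : BandSpace.{u}} (hX : isScheme X) (x : X.toSheafedSpace) :
    ∃ (A : BandCat.{u}) (j : specSheafed A ⟶ X.toSheafedSpace) (p : PrimeMIdeal A),
      SheafedSpace.IsOpenImmersion j ∧ j.hom.base p = x := by
  obtain ⟨U, hx, A, ⟨e⟩⟩ := hX x
  let e' : (X.restrict U).toSheafedSpace ≅ specSheafed A :=
    ⟨e.hom.toShHom, e.inv.toShHom, congrArg BandSpace.Hom.toShHom e.hom_inv_id,
      congrArg BandSpace.Hom.toShHom e.inv_hom_id⟩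
  let k : (X.restrict U).toSheafedSpace ⟶ X.toSheafedSpace :=
    X.toSheafedSpace.ofRestrict U.isOpenEmbedding
  have : SheafedSpace.IsOpenImmersion k :=
    PresheafedSpace.IsOpenImmersion.ofRestrict _ U.isOpenEmbedding
  have : IsIso e'.inv := e'.isIso_inv
  refine ⟨A, e'.inv ≫ k, e'.hom.hom.base ⟨x, hx⟩,
    SheafedSpace.IsOpenImmersion.comp e'.inv k, ?_⟩
  have h : (e'.hom ≫ e'.inv).hom.base ⟨x, hx⟩ = ⟨x, hx⟩ := by rw [e'.hom_inv_id]; rfl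
  exact congrArg k.hom.base h

/-- Both properties are local and hold on spectra, so they are transported along a chart. This is
the only place where the adjunction needs `X` to be a scheme and not merely a band space. -/
lemma hasOpenUnits_of_isScheme {X : BandSpace.{u}} (hX : isScheme X) :
    HasOpenUnits X.toSheafedSpace where
  zero_ne_one x h := by
    obtain ⟨A, j, p, -, rfl⟩ := exists_chart hX x
    refine p.zero_ne_one_localized ?_
    -- An equality `0 = 1` in the stalk of `X` is carried through the stalk of `Spec A` to `A_𝔭`,
    -- where it is false.
    have h' := congrArg (BandCat.hom (j.hom.stalkMap p ≫ stalkEval p)) h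
    rwa [map_zero, map_one] at h'
  exists_isUnit_map U x hx s hs := by
    obtain ⟨A, j, p, hj, rfl⟩ := exists_chart hX x
    let U' : Opens (PrimeMIdeal A) := (Opens.map j.hom.base).obj U
    have h1 : IsUnit ((structurePresheaf A).germ U' p hx (j.hom.c.app (op U) s)) := by
      have e := ConcreteCategory.congr_hom (PresheafedSpace.stalkMap_germ j.hom U p hx) s
      exact e ▸ hs.map (BandCat.hom (j.hom.stalkMap p))
    obtain ⟨V, hVU, hpV, hV⟩ :=
      exists_isUnit_res (B := A) U' _ ⟨p, hx⟩ ((isUnit_germ_iff p U' hx _).1 h1)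
    -- The image of `V` in `X` is open, and its inverse image is again `V` because the chart is
    -- injective.
    let W := hj.base_open.functor.obj V
    have hWU : W ≤ U := by
      rintro _ ⟨q, hq, rfl⟩
      exact hVU hq
    let W' : Opens (PrimeMIdeal A) := (Opens.map j.hom.base).obj W
    have hWV : W' ≤ V := by
      rintro q ⟨r, hr, hrq⟩
      exact hj.base_open.injective hrq ▸ hr
    refine ⟨W, homOfLE hWU, ⟨p, hpV, rfl⟩, ?_⟩
    -- An open immersion is an isomorphism on sections over an image, so invertibility over `V`
    -- descends to `W`.
    have : IsIso (j.hom.c.app (op W)) := hj.c_iso V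
    refine isUnit_of_isUnit_map (j.hom.c.app (op W)) ?_
    have e := ConcreteCategory.congr_hom (j.hom.c.naturality (homOfLE hWU).op) s
    have h2 := hV.map (Sections.res (B := A) hWV)
    exact e.symm ▸ h2

/-! ### Global sections of a spectrum -/

lemma Loc.isIso_ιHom_powers_one (B : BandCat.{u}) :
    IsIso (BandCat.ofHom (Loc.ιHom (Submonoid.powers (1 : B)))) := by
  have h : ∀ s : Submonoid.powers (1 : B), IsUnit (BandHom.id B s) := by
    rintro ⟨_, n, rfl⟩
    simp
  refine ⟨BandCat.ofHom (Loc.lift (BandHom.id B) h),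
    ConcreteCategory.hom_ext _ _ fun b => Loc.lift_ι _ h b, ?_⟩
  have e : (Loc.ιHom (Submonoid.powers (1 : B))).comp (Loc.lift (BandHom.id B) h) =
      BandHom.id _ := Loc.hom_ext fun b => congrArg (Loc.ιHom _) (Loc.lift_ι _ h b)
  exact congrArg BandCat.ofHom e

lemma isIso_constHom_basicOpen_one (B : BandCat.{u}) :
    IsIso (BandCat.ofHom (Sections.constHom (basicOpen (1 : B)))) := by
  have e : BandCat.ofHom (Sections.constHom (basicOpen (1 : B))) =
      BandCat.ofHom (Loc.ιHom (Submonoid.powers (1 : B))) ≫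
        BandCat.ofHom (awayToSections (1 : B)) :=
    ConcreteCategory.hom_ext _ _ fun b => (awayToSections_ι 1 b).symm
  have := Loc.isIso_ιHom_powers_one B
  have := isIso_awayToSections (1 : B)
  rw [e]
  infer_instance

instance isIso_toΓSpec (B : BandCat.{u}) : IsIso (toΓSpec B) := by
  -- No prime contains `1`, so global sections are the case `h = 1` of the formula for sections over
  -- `U_h`.
  have e : basicOpen (1 : B) = ⊤ := top_unique fun p _ => p.one_mem_compl
  have h := isIso_constHom_basicOpen_one B
  rw [e] at h
  exact h

/-! ### Morphisms into and out of sheaves of bands -/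

/-- The generating sets already form a basis, because `U_a ∩ U_b = U_{ab}`. -/
lemma PrimeMIdeal.exists_basicOpen_le {B : Type u} [Band B] {U : Opens (PrimeMIdeal B)}
    {p : PrimeMIdeal B} (hp : p ∈ U) : ∃ h : B, p ∈ basicOpen h ∧ basicOpen h ≤ U := by
  obtain ⟨U, hU⟩ := U
  change p ∈ U at hp
  induction hU with
  | basic s hs =>
    obtain ⟨h, rfl⟩ := hs
    exact ⟨h, hp, le_rfl⟩
  | univ => exact ⟨1, p.one_mem_compl, fun _ _ => trivial⟩
  | inter s t _ _ hs ht =>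
    obtain ⟨a, ha, has⟩ := hs hp.1
    obtain ⟨b, hb, hbt⟩ := ht hp.2
    exact ⟨a * b, p.mul_mem_compl ha hb, fun q hq =>
      ⟨has (mem_compl_of_dvd (Dvd.intro b rfl) hq), hbt (mem_compl_of_dvd (Dvd.intro_left a rfl) hq)⟩⟩
  | sUnion S _ ih =>
    obtain ⟨s, hs, hps⟩ := hp
    obtain ⟨h, hh, hhs⟩ := ih s hs hps
    exact ⟨h, hh, fun q hq => ⟨s, hs, hhs hq⟩⟩

lemma PrimeMIdeal.basicOpen_mul_le_left {B : Type u} [Band B] (a b : B) :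
    basicOpen (a * b) ≤ basicOpen a := fun _ hq => mem_compl_of_dvd (Dvd.intro b rfl) hq

lemma PrimeMIdeal.basicOpen_mul_le_right {B : Type u} [Band B] (a b : B) :
    basicOpen (a * b) ≤ basicOpen b := fun _ hq => mem_compl_of_dvd (Dvd.intro_left a rfl) hq

/-- The canonical morphism from a band to the sections over an open subset of its spectrum. -/
abbrev toSections (B : BandCat.{u}) (U : Opens (PrimeMIdeal B)) :
    B ⟶ (structurePresheaf B).obj (op U) :=
  BandCat.ofHom (Sections.constHom U)

lemma toSections_map {B : BandCat.{u}} {U V : Opens (PrimeMIdeal B)} (h : V ≤ U) :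
    toSections B U ≫ (structurePresheaf B).map (homOfLE (X := Opens (specTop B)) h).op =
      toSections B V := rfl

/-- The isomorphism between `B[h⁻¹]` and the sections over `U_h`. -/
def fromAway (B : BandCat.{u}) (h : B) :
    BandCat.of (Localization (Submonoid.powers h)) ⟶
      (structurePresheaf B).obj (op (basicOpen h)) :=
  BandCat.ofHom (awayToSections h)

instance (B : BandCat.{u}) (h : B) : IsIso (fromAway B h) := isIso_awayToSections h

lemma toAway_comp_fromAway (B : BandCat.{u}) (h : B) :
    BandCat.ofHom (Loc.ιHom (Submonoid.powers h)) ≫ fromAway B h =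
      toSections B (basicOpen h) :=
  ConcreteCategory.hom_ext _ _ fun b => awayToSections_ι h b

/-- Morphisms out of `B[h⁻¹]` are determined by their values on `B`. Cancelling this epimorphism is
how morphisms out of `𝒪(U_h)` are compared. -/
instance epi_toSections_basicOpen (B : BandCat.{u}) (h : B) :
    Epi (toSections B (basicOpen h)) := by
  have : Epi (BandCat.ofHom (Loc.ιHom (Submonoid.powers h))) := by
    refine ⟨fun k l e => ?_⟩
    have e' : BandCat.hom k = BandCat.hom l :=
      Loc.hom_ext fun b => ConcreteCategory.congr_hom e b
    exact ConcreteCategory.hom_ext _ _ fun b => DFunLike.congr_fun e' b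
  rw [← toAway_comp_fromAway]
  exact epi_comp _ _

/-- The extension of a morphism `B ⟶ C` that maps `h` to a unit to the sections over `U_h`. -/
def liftBasicOpen {B C : BandCat.{u}} {h : B} (g : B ⟶ C) (hg : IsUnit (g h)) :
    (structurePresheaf B).obj (op (basicOpen h)) ⟶ C :=
  inv (fromAway B h) ≫ BandCat.ofHom (Loc.lift (BandCat.hom g) (by
    rintro ⟨_, n, rfl⟩
    simpa only [map_pow] using hg.pow n))

@[simp] lemma toSections_liftBasicOpen {B C : BandCat.{u}} {h : B} (g : B ⟶ C)
    (hg : IsUnit (g h)) : toSections B (basicOpen h) ≫ liftBasicOpen g hg = g := by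
  rw [← toAway_comp_fromAway, liftBasicOpen, Category.assoc, IsIso.hom_inv_id_assoc]
  exact ConcreteCategory.hom_ext _ _ fun b => Loc.lift_ι _ _ b

lemma liftBasicOpen_comp {B C D : BandCat.{u}} {h : B} (g : B ⟶ C) (k : C ⟶ D)
    (hg : IsUnit (g h)) (hg' : IsUnit ((g ≫ k) h)) :
    liftBasicOpen g hg ≫ k = liftBasicOpen (g ≫ k) hg' := by
  rw [← cancel_epi (toSections B (basicOpen h)), toSections_liftBasicOpen, ← Category.assoc,
    toSections_liftBasicOpen]

/-- If `g` inverts both `h` and `h'`, it inverts `h * h'`, and both extensions factor through the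
sections over `U_{hh'} = U_h ∩ U_{h'}`. Thus the extension of `g` to sections over `U` does not
depend on the basic open set used. -/
lemma map_liftBasicOpen {B C : BandCat.{u}} {U : Opens (PrimeMIdeal B)} {h h' : B}
    (hU : basicOpen h ≤ U) (hU' : basicOpen h' ≤ U) (g : B ⟶ C) (hg : IsUnit (g h))
    (hg' : IsUnit (g h')) :
    (structurePresheaf B).map (homOfLE (X := Opens (specTop B)) hU).op ≫ liftBasicOpen g hg =
      (structurePresheaf B).map (homOfLE (X := Opens (specTop B)) hU').op ≫
        liftBasicOpen g hg' := by
  have hm : IsUnit (g (h * h')) := by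
    rw [map_mul]
    exact hg.mul hg'
  have e {a : B} (ha : IsUnit (g a)) (i : basicOpen (h * h') ≤ basicOpen a) :
      liftBasicOpen g ha =
        (structurePresheaf B).map (homOfLE (X := Opens (specTop B)) i).op ≫
          liftBasicOpen g hm := by
    rw [← cancel_epi (toSections B (basicOpen a)), toSections_liftBasicOpen, ← Category.assoc,
      toSections_map, toSections_liftBasicOpen]
  rw [e hg (basicOpen_mul_le_left h h'), e hg' (basicOpen_mul_le_right h h'), ← Category.assoc,
    ← Category.assoc, ← Functor.map_comp, ← Functor.map_comp]
  rfl

lemma SheafedSpace.hom_obj_ext (X : SheafedSpace BandCat.{u}) {E : BandCat.{u}} {U : Opens X}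
    {a b : E ⟶ X.presheaf.obj (op U)}
    (h : ∀ x ∈ U, ∃ (V : Opens X) (i : V ⟶ U), x ∈ V ∧
      a ≫ X.presheaf.map i.op = b ≫ X.presheaf.map i.op) : a = b := by
  let S : Sieve U :=
    { arrows := fun V i => a ≫ X.presheaf.map i.op = b ≫ X.presheaf.map i.op
      downward_closed := fun {V W i} hi j => by
        rw [op_comp, Functor.map_comp, ← Category.assoc, hi, Category.assoc] }
  have hS : S ∈ Opens.grothendieckTopology X U := fun x hx => by
    obtain ⟨V, i, hV, e⟩ := h x hx
    exact ⟨V, i, e, hV⟩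
  exact (X.IsSheaf E S hS).isSeparatedFor.ext fun V i hi => hi

/-- The sheaf condition is a statement about the presheaves `Hom(E, 𝒪(-))`, so whole morphisms are
glued instead of elements, and the result is a band morphism at no extra cost. -/
lemma SheafedSpace.exists_hom_obj (X : SheafedSpace BandCat.{u}) {E : BandCat.{u}} {U : Opens X}
    (S : Sieve U) (hS : ∀ x ∈ U, ∃ (V : Opens X) (i : V ⟶ U), S i ∧ x ∈ V)
    (k : ∀ ⦃V : Opens X⦄ (i : V ⟶ U), S i → (E ⟶ X.presheaf.obj (op V)))
    (hk : ∀ ⦃V W : Opens X⦄ (i : V ⟶ U) (hi : S i) (j : W ⟶ V),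
      k i hi ≫ X.presheaf.map j.op = k (j ≫ i) (S.downward_closed hi j)) :
    ∃ t : E ⟶ X.presheaf.obj (op U), ∀ ⦃V : Opens X⦄ (i : V ⟶ U) (hi : S i),
      t ≫ X.presheaf.map i.op = k i hi := by
  have hc : Presieve.FamilyOfElements.Compatible (P := X.presheaf ⋙ coyoneda.obj (op E)) k :=
    (Presieve.compatible_iff_sieveCompatible _).2 fun V W i j hi => (hk i hi j).symm
  obtain ⟨t, ht, -⟩ := X.IsSheaf E S (fun x hx => hS x hx) k hc
  exact ⟨t, ht⟩

/-! ### The morphism to the spectrum given by a morphism to the global sections -/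

/-- The nonunits of a nontrivial band form a prime `m`-ideal. -/
def PrimeMIdeal.nonunits (C : Type u) [Band C] (h : (0 : C) ≠ 1) : PrimeMIdeal C where
  carrier := {c | ¬ IsUnit c}
  isMIdeal :=
    { zero_mem := fun h0 => h (isUnit_zero_iff.1 h0)
      mul_mem := fun _ _ ha hb => ha (isUnit_of_mul_isUnit_right hb) }
  one_mem_compl := fun h1 => h1 isUnit_one
  mul_mem_compl ha hb := fun hab => hab ((not_not.1 ha).mul (not_not.1 hb))

namespace ToSpec

variable {X : SheafedSpace BandCat.{u}} (hX : HasOpenUnits X) {B : BandCat.{u}}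
  (f : B ⟶ X.presheaf.obj (op ⊤))

/-- The prime `m`-ideal of the elements whose germ at a point is not a unit. -/
def point (x : X) : PrimeMIdeal B :=
  comap (BandCat.hom (f ≫ X.presheaf.germ ⊤ x trivial))
    (PrimeMIdeal.nonunits _ (hX.zero_ne_one x))

lemma mem_compl_point {x : X} {b : B} :
    b ∈ (point hX f x).compl ↔ IsUnit (X.presheaf.germ ⊤ x trivial (f b)) := not_not

/-- The composition of a morphism to the global sections with the restriction to an open subset. -/
def restr (U : Opens X) : B ⟶ X.presheaf.obj (op U) :=
  f ≫ X.presheaf.map (homOfLE le_top : U ⟶ ⊤).op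

lemma restr_map {U V : Opens X} (i : V ⟶ U) : restr f U ≫ X.presheaf.map i.op = restr f V := by
  rw [restr, Category.assoc, ← Functor.map_comp]
  rfl

lemma restr_germ (U : Opens X) (x : X) (hx : x ∈ U) :
    restr f U ≫ X.presheaf.germ U x hx = f ≫ X.presheaf.germ ⊤ x trivial := by
  rw [restr, Category.assoc, X.presheaf.germ_res]

lemma isUnit_restr_of_hom {h : B} {U V : Opens X} (i : V ⟶ U) (hU : IsUnit (restr f U h)) :
    IsUnit (restr f V h) := by
  rw [← restr_map f i]
  exact hU.map (BandCat.hom (X.presheaf.map i.op))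

lemma mem_compl_point_of_isUnit_restr {h : B} {V : Opens X} (hV : IsUnit (restr f V h)) {x : X}
    (hx : x ∈ V) : h ∈ (point hX f x).compl := by
  have e := ConcreteCategory.congr_hom (restr_germ f V x hx) h
  exact (mem_compl_point hX f).2 (e ▸ hV.map (BandCat.hom (X.presheaf.germ V x hx)))

/-- Together with `mem_compl_point_of_isUnit_restr`, this exhibits the inverse image of `U_h` as the
union of the open sets on which `f h` becomes a unit; continuity follows. -/
lemma exists_isUnit_restr {h : B} {x : X} (hx : h ∈ (point hX f x).compl) :
    ∃ V : Opens X, x ∈ V ∧ IsUnit (restr f V h) := by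
  obtain ⟨V, i, hxV, hV⟩ := hX.exists_isUnit_map ⊤ x trivial _ ((mem_compl_point hX f).1 hx)
  exact ⟨V, hxV, hV⟩

/-- The continuous map to the spectrum. -/
def base : (X : TopCat) ⟶ specTop B :=
  TopCat.ofHom ⟨point hX f, continuous_generateFrom_iff.2 (by
    rintro _ ⟨h, rfl⟩
    refine isOpen_iff_forall_mem_open.2 fun x hx => ?_
    obtain ⟨V, hxV, hV⟩ := exists_isUnit_restr hX f (h := h) hx
    exact ⟨V, fun y hy => mem_compl_point_of_isUnit_restr hX f hV hy, V.isOpen, hxV⟩)⟩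

lemma exists_isUnit_restr_of_mem {U : Opens (specTop B)} {x : X} (hx : point hX f x ∈ U) :
    ∃ (h : B) (V : Opens X) (_ : V ⟶ (Opens.map (base hX f)).obj U), x ∈ V ∧ basicOpen h ≤ U ∧
      IsUnit (restr f V h) := by
  obtain ⟨h, hh, hU⟩ := exists_basicOpen_le hx
  obtain ⟨V, hxV, hV⟩ := exists_isUnit_restr hX f hh
  exact ⟨h, V, homOfLE fun y hy => hU (mem_compl_point_of_isUnit_restr hX f hV hy), hxV, hU, hV⟩

/-- The open sets on which `f` inverts some `h` with `U_h ⊆ U` cover the inverse image of `U`. On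
each of them the extension of `f` to `𝒪(U_h)` is available, and these extensions are glued. The
stated formula, valid for every admissible `h` and `V`, characterizes the result. -/
lemma exists_app (U : Opens (specTop B)) :
    ∃ t : (structurePresheaf B).obj (op U) ⟶ X.presheaf.obj (op ((Opens.map (base hX f)).obj U)),
      ∀ (h : B) (hU : basicOpen h ≤ U) (V : Opens X) (i : V ⟶ (Opens.map (base hX f)).obj U)
        (hV : IsUnit (restr f V h)), t ≫ X.presheaf.map i.op =
          (structurePresheaf B).map (homOfLE (X := Opens (specTop B)) hU).op ≫
            liftBasicOpen (restr f V) hV := by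
  let S : Sieve ((Opens.map (base hX f)).obj U) :=
    { arrows := fun V _ => ∃ h : B, basicOpen h ≤ U ∧ IsUnit (restr f V h)
      downward_closed := fun {V W i} ⟨h, hU, hV⟩ j => ⟨h, hU, isUnit_restr_of_hom f j hV⟩ }
  obtain ⟨t, ht⟩ := SheafedSpace.exists_hom_obj X (E := (structurePresheaf B).obj (op U)) S
    (fun x hx => by
      obtain ⟨h, V, i, hxV, hU, hV⟩ := exists_isUnit_restr_of_mem hX f hx
      exact ⟨V, i, ⟨h, hU, hV⟩, hxV⟩)
    (fun V _ hi => (structurePresheaf B).map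
      (homOfLE (X := Opens (specTop B)) hi.choose_spec.1).op ≫
        liftBasicOpen (restr f V) hi.choose_spec.2)
    (fun V W i hi j => by
      have hu := isUnit_restr_of_hom f j hi.choose_spec.2
      rw [Category.assoc, liftBasicOpen_comp _ _ _ (by rwa [restr_map])]
      simp only [restr_map]
      -- The elements `h` chosen for `V` and for the smaller set `W` may differ, which the
      -- independence of `h` makes harmless.
      exact map_liftBasicOpen _ _ _ _ _)
  exact ⟨t, fun h hU V i hV => (ht i ⟨h, hU, hV⟩).trans (map_liftBasicOpen _ _ _ _ _)⟩

/-- The map from the sections over `U` to the sections over the inverse image of `U`. -/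
def app (U : Opens (specTop B)) :
    (structurePresheaf B).obj (op U) ⟶ X.presheaf.obj (op ((Opens.map (base hX f)).obj U)) :=
  (exists_app hX f U).choose

lemma app_map {U : Opens (specTop B)} {h : B} (hU : basicOpen h ≤ U) {V : Opens X}
    (i : V ⟶ (Opens.map (base hX f)).obj U) (hV : IsUnit (restr f V h)) :
    app hX f U ≫ X.presheaf.map i.op =
      (structurePresheaf B).map (homOfLE (X := Opens (specTop B)) hU).op ≫
        liftBasicOpen (restr f V) hV :=
  (exists_app hX f U).choose_spec h hU V i hV

/-- An `h` with `U_h ⊆ U'` also serves for `U`, so locally both sides are the same extension of `f`.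
-/
lemma app_naturality {U U' : Opens (specTop B)} (i : U' ⟶ U) :
    (structurePresheaf B).map i.op ≫ app hX f U' =
      app hX f U ≫ X.presheaf.map ((Opens.map (base hX f)).map i).op := by
  refine SheafedSpace.hom_obj_ext X fun x hx => ?_
  obtain ⟨h, V, j, hxV, hU, hV⟩ := exists_isUnit_restr_of_mem hX f hx
  refine ⟨V, j, hxV, ?_⟩
  rw [Category.assoc, Category.assoc, app_map hX f hU j hV, ← Functor.map_comp, ← op_comp,
    app_map hX f (hU.trans (leOfHom i)) _ hV, ← Category.assoc, ← Functor.map_comp]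
  rfl

/-- The constructed morphism restricts to `f` on elements of `B`; for `U = ⊤` this is the
surjectivity of the pull back of global sections. -/
lemma toSections_app (U : Opens (specTop B)) :
    toSections B U ≫ app hX f U = restr f ((Opens.map (base hX f)).obj U) := by
  refine SheafedSpace.hom_obj_ext X fun x hx => ?_
  obtain ⟨h, V, j, hxV, hU, hV⟩ := exists_isUnit_restr_of_mem hX f hx
  refine ⟨V, j, hxV, ?_⟩
  rw [Category.assoc, app_map hX f hU j hV, ← Category.assoc, toSections_map,
    toSections_liftBasicOpen, restr_map]

/-- The morphism to the spectrum. -/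
def hom : X ⟶ specSheafed B :=
  InducedCategory.homMk
    { base := base hX f
      c :=
        { app := fun U => app hX f U.unop
          naturality := fun _ _ i => app_naturality hX f i.unop } }

/-- Near the image `p` of `x`, a section `s` satisfies `g * s = b` with `g ∉ p`. By the choice of
`p`, the image of `g` in the stalk at `x` is a unit. If the image of `s` is one too, so is that of
`b`; hence `b ∉ p`, and `s` takes the invertible value `b / g` at `p`. -/
lemma isLocal_hom : BandSpace.IsLocal (hom hX f) := by
  intro x a ha h
  apply ha
  obtain ⟨U, hU, s, rfl⟩ := exists_germ_eq (structurePresheaf B) _ a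
  let p : PrimeMIdeal B := point hX f x
  change p ∈ U at hU
  have e1 := ConcreteCategory.congr_hom (PresheafedSpace.stalkMap_germ (hom hX f).hom U x hU) s
  have h1 : IsUnit (X.presheaf.germ ((Opens.map (base hX f)).obj U) x hU (app hX f U s)) :=
    e1 ▸ h
  refine isUnit_germ (B := B) p U hU s ?_
  obtain ⟨W, hW, b, g, hs⟩ := Sections.prop (B := B) s ⟨p, hU⟩
  obtain ⟨hg, hsp⟩ := hs ⟨p, hU⟩ hW
  -- On `V` the equation `g * s = b` holds at every point, hence as an equation of sections, to
  -- which `F` can be applied.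
  let V : Opens (PrimeMIdeal B) := U ⊓ W
  have hVU : V ≤ U := inf_le_left
  have hxU : x ∈ (Opens.map (base hX f)).obj U := hU
  have hxV : x ∈ (Opens.map (base hX f)).obj V := ⟨hU, hW⟩
  let F := app hX f V ≫ X.presheaf.germ ((Opens.map (base hX f)).obj V) x hxV
  have hF (c : B) : F (toSections B V c) = X.presheaf.germ ⊤ x trivial (f c) := by
    have e : toSections B V ≫ F = f ≫ X.presheaf.germ ⊤ x trivial := by
      rw [← Category.assoc, toSections_app, restr_germ]
    exact ConcreteCategory.congr_hom e c
  have e2 : F (Sections.res (B := B) hVU s) =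
      X.presheaf.germ ((Opens.map (base hX f)).obj U) x hxU (app hX f U s) := by
    have e : (structurePresheaf B).map (homOfLE (X := Opens (specTop B)) hVU).op ≫ F =
        app hX f U ≫ X.presheaf.germ ((Opens.map (base hX f)).obj U) x hxU := by
      rw [← Category.assoc, app_naturality, Category.assoc, X.presheaf.germ_res]
    exact ConcreteCategory.congr_hom e s
  have e3 : Sections.constHom V g * Sections.res (B := B) hVU s = Sections.constHom V b := by
    refine Sections.ext fun q => ?_
    obtain ⟨hg, hs⟩ := hs ⟨q.1, q.2.1⟩ q.2.2
    exact (Loc.eq_mk_iff _ b ⟨g, hg⟩).1 hs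
  have hb : b ∈ p.compl := by
    refine (mem_compl_point hX f).2 ?_
    rw [← hF b]
    let F' : BandHom (Sections V) (X.presheaf.stalk x) := BandCat.hom F
    have hg' : IsUnit (F' (Sections.constHom V g)) := (hF g).symm ▸ (mem_compl_point hX f).1 hg
    have hs' : IsUnit (F' (Sections.res (B := B) hVU s)) := e2.symm ▸ h1
    have e4 := (map_mul F' _ _).symm.trans (congrArg F' e3)
    exact e4 ▸ hg'.mul hs'
  rw [hsp]
  exact IsUnit.of_mul_eq_one _ (mul_mk_eq_one p b g hb hg)

end ToSpec

/-! ### Uniqueness of local morphisms to a spectrum -/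

/-- A local morphism to a spectrum is determined by the pull back of global sections. -/
lemma hom_toSpec_ext {X : SheafedSpace BandCat.{u}} {B : BandCat.{u}} {α β : X ⟶ specSheafed B}
    (hα : BandSpace.IsLocal α) (hβ : BandSpace.IsLocal β)
    (h : toSections B ⊤ ≫ α.hom.c.app (op ⊤) = toSections B ⊤ ≫ β.hom.c.app (op ⊤)) : α = β := by
  -- The global sections determine the point `γ x`. That units pull back to units holds for any
  -- morphism; the reverse implication is locality.
  have key {γ : X ⟶ specSheafed B} (hγ : BandSpace.IsLocal γ) (x : X) (b : B) :
      b ∈ (show PrimeMIdeal B from γ.hom.base x).compl ↔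
        IsUnit (X.presheaf.germ ⊤ x trivial
          ((toSections B ⊤ ≫ γ.hom.c.app (op ⊤)) b)) := by
    let p : PrimeMIdeal B := γ.hom.base x
    have e : γ.hom.stalkMap x
        ((structurePresheaf B).germ ⊤ p trivial (Sections.constHom ⊤ b)) =
          X.presheaf.germ ⊤ x trivial ((toSections B ⊤ ≫ γ.hom.c.app (op ⊤)) b) :=
      ConcreteCategory.congr_hom (PresheafedSpace.stalkMap_germ γ.hom ⊤ x trivial)
        (Sections.constHom ⊤ b)
    rw [← e]
    refine (Loc.isUnit_ιHom_iff p b).symm.trans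
      ((isUnit_germ_iff p ⊤ trivial (Sections.constHom ⊤ b)).symm.trans ⟨fun h => ?_, fun h => ?_⟩)
    · exact h.map (BandCat.hom (γ.hom.stalkMap x))
    · exact not_not.1 fun h' => hγ x _ h' h
  have hbase : α.hom.base = β.hom.base := by
    refine TopCat.hom_ext (ContinuousMap.ext fun x => PrimeMIdeal.ext (Set.ext fun b => ?_))
    have h' := (key hα x b).trans ((h ▸ (key hβ x b).symm))
    exact not_iff_not.1 h'
  obtain ⟨⟨a, c⟩⟩ := α
  obtain ⟨⟨b, d⟩⟩ := β
  obtain rfl : a = b := hbase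
  suffices hcd : c = d by rw [hcd]
  refine NatTrans.ext (funext fun ⟨U⟩ => ?_)
  refine SheafedSpace.hom_obj_ext X fun x hx => ?_
  -- With the maps of spaces identified, it suffices to compare the components on inverse images of
  -- basic open sets, and by naturality only the components at `U_g` matter.
  obtain ⟨g, hg, hU⟩ := exists_basicOpen_le (B := B) hx
  let V : Opens (specTop B) := basicOpen g
  let i : V ⟶ U := homOfLE hU
  refine ⟨(Opens.map a).obj V, (Opens.map a).map i, hg, ?_⟩
  refine (c.naturality i.op).symm.trans (Eq.trans ?_ (d.naturality i.op))
  refine congrArg ((specSheafed B).presheaf.map i.op ≫ ·)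
    ((cancel_epi (toSections B (basicOpen g))).1 ?_)
  -- After composition with the epimorphism `B → 𝒪(U_g)`, both components factor through the one at
  -- `⊤`, where `h` applies.
  let j : V ⟶ ⊤ := homOfLE le_top
  have hc := congrArg (toSections B ⊤ ≫ ·) (c.naturality j.op)
  have hd := congrArg (toSections B ⊤ ≫ ·) (d.naturality j.op)
  refine hc.trans (Eq.trans ?_ hd.symm)
  exact congrArg (· ≫ X.presheaf.map ((Opens.map a).map j).op) h

/-! ### The adjunction between global sections and the spectrum -/

lemma pullbackSections_bijective (X : BSch.{u}) (B : BandCat.{u}) :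
    Function.Bijective (pullbackSections X B) := by
  refine ⟨fun φ ψ h => ?_, fun f => ?_⟩
  · refine ObjectProperty.hom_ext _ (BandSpace.hom_ext ?_)
    exact hom_toSpec_ext φ.hom.isLocal ψ.hom.isLocal h
  · have hX := hasOpenUnits_of_isScheme X.property
    refine ⟨ObjectProperty.homMk ⟨ToSpec.hom hX f, ToSpec.isLocal_hom hX f⟩, ?_⟩
    refine (ToSpec.toSections_app hX f ⊤).trans ?_
    -- For `U = ⊤`, the restriction of `f` is along the identity of `⊤`.
    exact (congrArg (f ≫ ·) (X.obj.toSheafedSpace.presheaf.map_id (op ⊤))).trans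
      (Category.comp_id f)

lemma pullbackSections_comp_left {X X' : BSch.{u}} (g : X' ⟶ X) (B : BandCat.{u})
    (φ : X ⟶ Spec.obj (op B)) :
    pullbackSections X' B (g ≫ φ) = pullbackSections X B φ ≫ Γ.map g.op := by
  rw [pullbackSections, pullbackSections, op_comp, Functor.map_comp, Category.assoc]

lemma toΓSpec_naturality {B B' : BandCat.{u}} (f : B' ⟶ B) :
    toΓSpec B' ≫ Γ.map (Bands.Spec.map f.op).op = f ≫ toΓSpec B :=
  ConcreteCategory.hom_ext _ _ fun b =>
    Sections.ext (B := B) fun p => localMap_ι (BandCat.hom f) p.1 b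

lemma pullbackSections_comp_right (X : BSch.{u}) {B B' : BandCat.{u}} (f : B' ⟶ B)
    (φ : X ⟶ Spec.obj (op B)) :
    pullbackSections X B' (φ ≫ Bands.Spec.map f.op) = f ≫ pullbackSections X B φ := by
  rw [pullbackSections, pullbackSections, op_comp, Functor.map_comp, ← Category.assoc,
    toΓSpec_naturality, Category.assoc]

/-- The bijection `Hom(B, Γ X) ≃ Hom(X, Spec B)`. -/
def homEquiv (X : BSch.{u}) (B : BandCat.{u}ᵒᵖ) :
    (Γ.rightOp.obj X ⟶ B) ≃ (X ⟶ Spec.obj B) :=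
  (opEquiv _ _).trans (Equiv.ofBijective _ (pullbackSections_bijective X B.unop)).symm

/-- The global sections are left adjoint to the spectrum. -/
def adjunction : Γ.{u}.rightOp ⊣ Spec.{u} :=
  Adjunction.mkOfHomEquiv
    { homEquiv := homEquiv
      homEquiv_naturality_left_symm := fun {X' X B} g φ =>
        congrArg Quiver.Hom.op (pullbackSections_comp_left g B.unop φ)
      homEquiv_naturality_right := fun {X B B'} k f => by
        refine ((homEquiv X B').symm_apply_eq.1 ?_).symm
        refine (congrArg Quiver.Hom.op (pullbackSections_comp_right X f.unop _)).trans ?_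
        exact congrArg (· ≫ f) ((homEquiv X B).symm_apply_apply k) }

lemma adjunction_homEquiv_symm (X : BSch.{u}) (B : BandCat.{u}) (φ : X ⟶ Spec.obj (op B)) :
    (adjunction.homEquiv X (op B)).symm φ = (pullbackSections X B φ).op := by
  rw [adjunction, Adjunction.mkOfHomEquiv_homEquiv]
  rfl

/-- The counit at `B` corresponds to the identity of `Spec B`, so it is the canonical map `B → Γ
Spec B`, an isomorphism. This is what makes the right adjoint fully faithful. -/
instance : IsIso adjunction.{u}.counit := by
  refine @NatIso.isIso_of_isIso_app _ _ _ _ _ _ _ fun B => ?_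
  have e : adjunction.counit.app B = (toΓSpec B.unop).op := by
    rw [← Adjunction.homEquiv_symm_id]
    refine (adjunction_homEquiv_symm _ B.unop _).trans (congrArg Quiver.Hom.op ?_)
    exact (congrArg (toΓSpec B.unop ≫ ·) (Γ.map_id _)).trans (Category.comp_id _)
  rw [e]
  infer_instance

/-- The spectrum is fully faithful. -/
def fullyFaithfulSpec : Spec.{u}.FullyFaithful := adjunction.fullyFaithfulROfIsIsoCounit

/-- The inclusion of affine band schemes into band schemes is fully faithful. -/
def fullyFaithfulAffineInclusion : affineInclusion.{u}.FullyFaithful :=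
  ObjectProperty.fullyFaithfulιOfLE _

/-- The spectrum and the global sections of affine band schemes are adjoint. -/
def affineAdjunction : affineInclusion.{u} ⋙ Γ.rightOp ⊣ SpecAff.{u} :=
  adjunction.restrictFullyFaithful fullyFaithfulAffineInclusion
    (Functor.FullyFaithful.id _) (Iso.refl _) (Iso.refl _)

/-- The spectrum as a functor to affine band schemes is fully faithful. -/
def fullyFaithfulSpecAff : SpecAff.{u}.FullyFaithful :=
  have := fullyFaithfulAffineInclusion.{u}.faithful
  Functor.FullyFaithful.ofCompFaithful (G := affineInclusion) fullyFaithfulSpec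

instance : SpecAff.{u}.Full := fullyFaithfulSpecAff.full

instance : SpecAff.{u}.Faithful := fullyFaithfulSpecAff.faithful

instance : SpecAff.{u}.EssSurj where
  mem_essImage := by
    rintro ⟨X, B, ⟨e⟩⟩
    exact ⟨op B, ⟨isAffine.isoMk e.symm⟩⟩

/-- The equivalence between the opposite category of bands and affine band schemes. -/
def specEquivalence : BandCat.{u}ᵒᵖ ≌ BAff.{u} :=
  have : SpecAff.{u}.IsEquivalence := {}
  -- Taking the equivalence from the adjunction makes its inverse the global sections by definition,
  -- not an unspecified choice.
  affineAdjunction.toEquivalence.symm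

/-- The reflection of band schemes to affine band schemes. -/
@[reducible]
def reflectiveAffineInclusion : Reflective affineInclusion.{u} where
  toFull := fullyFaithfulAffineInclusion.full
  toFaithful := fullyFaithfulAffineInclusion.faithful
  L := Γ.rightOp ⋙ SpecAff
  -- The composite right adjoint is `X ↦ Spec Γ X` on affine `X`; the counit of the equivalence
  -- identifies it with the inclusion.
  adj := (adjunction.comp specEquivalence.toAdjunction).ofNatIsoRight
    (Functor.isoWhiskerRight specEquivalence.counitIso affineInclusion ≪≫
      affineInclusion.leftUnitor)

end Bands

end

theorem mainTheorem1 :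
    -- `Spec` is fully faithful
    (Bands.Spec.{u}.Full ∧ Bands.Spec.{u}.Faithful) ∧
    -- pulling back global sections is a bijection `Hom(X, Spec B) → Hom(B, Γ X)`
    (∀ (X : Bands.BSch.{u}) (B : Bands.BandCat.{u}),
      Function.Bijective (Bands.pullbackSections X B)) ∧
    -- it is functorial in `X`
    (∀ (X X' : Bands.BSch.{u}) (g : X' ⟶ X) (B : Bands.BandCat.{u})
      (φ : X ⟶ Bands.Spec.obj (op B)),
      Bands.pullbackSections X' B (g ≫ φ) = Bands.pullbackSections X B φ ≫ Bands.Γ.map g.op) ∧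
    -- it is functorial in `B`
    (∀ (X : Bands.BSch.{u}) (B B' : Bands.BandCat.{u}) (f : B' ⟶ B)
      (φ : X ⟶ Bands.Spec.obj (op B)),
      Bands.pullbackSections X B' (φ ≫ Bands.Spec.map f.op) = f ≫ Bands.pullbackSections X B φ) ∧
    -- it is the bijection of an adjunction between `Γ` and `Spec`
    (∃ adj : Bands.Γ.{u}.rightOp ⊣ Bands.Spec.{u},
      ∀ (X : Bands.BSch.{u}) (B : Bands.BandCat.{u}) (φ : X ⟶ Bands.Spec.obj (op B)),
        (adj.homEquiv X (op B)).symm φ = (Bands.pullbackSections X B φ).op) ∧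
    -- `Spec` is an anti-equivalence between bands and affine band schemes with inverse `Γ`
    (∃ e : Bands.BandCat.{u}ᵒᵖ ≌ Bands.BAff.{u},
      e.functor = Bands.SpecAff ∧ e.inverse = Bands.affineInclusion ⋙ Bands.Γ.rightOp) ∧
    -- affine band schemes are a reflective subcategory of band schemes with reflection `Spec ∘ Γ`
    (∃ r : Reflective Bands.affineInclusion.{u}, r.L = Bands.Γ.rightOp ⋙ Bands.SpecAff) :=
  ⟨⟨Bands.fullyFaithfulSpec.full, Bands.fullyFaithfulSpec.faithful⟩,
    Bands.pullbackSections_bijective,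
    fun _ _ g B φ => Bands.pullbackSections_comp_left g B φ,
    fun X _ _ f φ => Bands.pullbackSections_comp_right X f φ,
    ⟨Bands.adjunction, Bands.adjunction_homEquiv_symm⟩,
    ⟨Bands.specEquivalence, rfl, rfl⟩,
    ⟨Bands.reflectiveAffineInclusion, rfl⟩⟩
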